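/- Let $\mathcal C$ be a category with a subcategory of *covers* such that: $\mathcal C$ has a terminal object $*$ and every map $X\to *$ is a cover; pullbacks of covers along arbitrary maps exist and are covers; if $fg$ and $g$ are covers then so is $f$; every cover is the coequalizer of its kernel pair. *Conventions.* For a simplicial object $X_\bullet$ of $\mathcal C$ and a simplicial set $S$ put $\hom(S,X)=\lim_{\Delta^k\to S}X_k$ (if it exists). For $f:X_\bullet\to Y_\bullet$ and $A\subseteq\Delta^k$ consider the limit $\hom(A,X)\times_{\hom(A,Y)}Y_k$; it is denoted $M_k(f)$ for $A=\partial\Delta^k$ and $\Lambda^k_i(f)$ for $A=\Lambda^k_i$. A *Lie $\infty$-groupoid* is a simplicial object $X_\bullet$ for which all limits $\hom(\Lambda^k_i,X)$ ($k>0$, $0\le i\le k$) exist and all maps $X_k\to\hom(\Lambda^k_i,X)$ are covers. For $n\in\mathbb N\cup\{\infty\}$, a map $f:X_\bullet\to Y_\bullet$ of Lie $\infty$-groupoids is an *$n$-hypercover* if for all $k\ge0$ the limit $M_k(f)$ exists and the map $X_k\to M_k(f)$ is a cover, and an isomorphism if $k\ge n$; a *hypercover* is an $\infty$-hypercover. For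 $n\in\mathbb N$, let $P^{\ge n}(f)_\bullet$ be the pullback of $X^{\Delta^{n-1}\star}_\bullet\to X^{\partial\Delta^{n-1}\star}_\bullet\times_{Y^{\partial\Delta^{n-1}\star}_\bullet}Y^{\Delta^{n-1}\star}_\bullet$ along the map from the constant simplicial object $\Lambda^n_n(f)$ on the vertices of the target, where $X^{S\star}_l=\hom(S\star\Delta^l,X)$; its vertices are $X_n$. For $n=0$ this is read as $P^{\ge0}(f)_\bullet=X_\bullet\times_{Y_\bullet}Y_0$. The orbit space $\pi_0(P_\bullet)$, if it exists, is a cover $P_0\to\pi_0(P_\bullet)$ that is a coequalizer of the face maps $P_1\rightrightarrows P_0$. The *$n$-strictification* of $f$, if it exists, is a simplicial object $\tau_n(X,f)_\bullet$ with maps $X_\bullet\xrightarrow{\ q\ }\tau_n(X,f)_\bullet\xrightarrow{\tau_n(f)}Y_\bullet$ composing to $f$ such that: $q_k$ is an isomorphism for $k<n$; $P^{\ge n}(f)_\bullet$ exists and $q_n:X_n\to\tau_n(X,f)_n$ is its orbit space; the map $\tau_n(X,f)_{n+1}\to\Lambda^{n+1}_1(\tau_n(f))$ is an isomorphism; and $\tau_n(X,f)_\bullet$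 is $\mathrm{Csk}_{n+1}\tau_n(X,f)_\bullet\times_{\mathrm{Csk}_{n+1}Y_\bullet}Y_\bullet$, via the canonical map. Here $(\mathrm{Csk}_m X)_k=\hom(\mathrm{Sk}_m\Delta^k,X)$, the fibre product being formed as the limit $\hom(\mathrm{Sk}_m\Delta^k,X)\times_{\hom(\mathrm{Sk}_m\Delta^k,Y)}Y_k$ in each degree $k$, and $\mathrm{Sk}_{-1}\Delta^k=\emptyset$, so that $\mathrm{Csk}_{-1}X=*$. **Proposition.** Let $f:X_\bullet\to Y_\bullet$ be a hypercover and let $n\ge0$ be an integer. Then the $n$-strictification of $f$ exists, and for every $n$-strictification $X_\bullet\xrightarrow{\ q\ }\tau_n(X,f)_\bullet\xrightarrow{\tau_n(f)}Y_\bullet$: 1. the map $\tau_n(f):\tau_n(X,f)_\bullet\to Y_\bullet$ is an $n$-hypercover (in particular $\tau_n(X,f)_\bullet$ is a Lie $\infty$-groupoid); 2. the canonical map $q:X_\bullet\to\tau_n(X,f)_\bullet$ is a hypercover; 3. canonically, compatibly with the maps from $X_\bullet$ and to $Y_\bullet$, $$\tau_n(X,f)_\bullet\cong\mathrm{Csk}_{n-1}X_\bullet\times_{\mathrm{Csk}_{n-1}Y_\bullet}Y_\bullet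 .$$ -/

import Mathlib

universe v u

open CategoryTheory CategoryTheory.Limits Opposite
open scoped Simplicial

namespace HigherStack

variable {C : Type u} [Category.{v} C]

/-- A subcategory of covers in a category: every map to the terminal object is a cover,
pullbacks of covers along arbitrary maps exist and are covers, covers can be cancelled on the
right, and every cover is the coequalizer of its kernel pair. -/
structure IsCoverClass (W : MorphismProperty C) : Prop where
  isMultiplicative : W.IsMultiplicative
  exists_terminal : ∃ pt : C, Nonempty (IsTerminal pt) ∧ ∀ (X : C) (g : X ⟶ pt), W g
  hasPullback : ∀ {X Y Z : C} (f : X ⟶ Z) (g : Y ⟶ Z), W f → HasPullback f g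
  isStableUnderBaseChange : W.IsStableUnderBaseChange
  of_comp : ∀ {X Y Z : C} (g : X ⟶ Y) (f : Y ⟶ Z), W (g ≫ f) → W g → W f
  effective : ∀ {X Y : C} (f : X ⟶ Y), W f → ∀ {R : C} (a b : R ⟶ X)
    (h : IsKernelPair f a b), Nonempty (IsColimit (Cofork.ofπ f h.w))

/-! ### The limits `hom(S, X)` and `hom(A, X) ×_{hom(A, Y)} Y_k` -/

/-- Cones with apex `U` over the diagram `(Δ^j → S) ↦ X_j` indexed by the simplices of `S`.
A limit of this diagram is `hom(S, X)`. -/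
@[ext]
structure HomCone (S : SSet.{0}) (X : SimplicialObject C) (U : C) where
  /-- the component at a simplex of `S` -/
  π : ∀ {j : SimplexCategory}, S.obj (op j) → (U ⟶ X.obj (op j))
  w : ∀ {i j : SimplexCategory} (φ : i ⟶ j) (a : S.obj (op j)),
    π a ≫ X.map φ.op = π (S.map φ.op a)

/-- Restriction of a cone along a map of apices. -/
def HomCone.precomp {S : SSet.{0}} {X : SimplicialObject C} {U V : C} (c : HomCone S X U)
    (g : V ⟶ U) : HomCone S X V where
  π a := g ≫ c.π a
  w φ a := by rw [Category.assoc, c.w]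

/-- The cone is universal: its apex is the limit `hom(S, X)`. -/
def HomCone.IsUniversal {S : SSet.{0}} {X : SimplicialObject C} {M : C}
    (c : HomCone S X M) : Prop :=
  ∀ (U : C) (t : HomCone S X U), ∃! g : U ⟶ M, c.precomp g = t

/-- For a simplicial subset `A` of `Δ^k`, the cone with apex `X_k` which induces the
restriction map `X_k → hom(A, X)`. -/
def HomCone.restriction (X : SimplicialObject C) {k : ℕ} (A : (Δ[k] : SSet.{0}).Subcomplex) :
    HomCone (A : SSet.{0}) X (X.obj (op ⦋k⦌)) where
  π a := X.map (SSet.stdSimplex.objEquiv a.1).op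
  w φ a := by
    rw [← X.map_comp]
    rfl

/-- Cones with apex `U` over the diagram whose limit is `hom(A, X) ×_{hom(A, Y)} Y_k`, where
`A` is a simplicial subset of `Δ^k`: a map from `U` to `Y_k`, together with a lift to `X` of
its restriction to `A`. -/
@[ext]
structure RelCone {X Y : SimplicialObject C} (f : X ⟶ Y) {k : ℕ}
    (A : (Δ[k] : SSet.{0}).Subcomplex) (U : C) where
  /-- the component in `hom(A, X)` -/
  lift : HomCone (A : SSet.{0}) X U
  /-- the component in `Y_k` -/
  base : U ⟶ Y.obj (op ⦋k⦌)
  comm : ∀ {j : SimplexCategory} (a : (A : SSet.{0}).obj (op j)),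
    lift.π a ≫ f.app (op j) = base ≫ Y.map (SSet.stdSimplex.objEquiv a.1).op

namespace RelCone

variable {X Y : SimplicialObject C} {f : X ⟶ Y} {k : ℕ} {A : (Δ[k] : SSet.{0}).Subcomplex}

/-- Restriction of a cone along a map of apices. -/
def precomp {U V : C} (c : RelCone f A U) (g : V ⟶ U) : RelCone f A V where
  lift := c.lift.precomp g
  base := g ≫ c.base
  comm a := by
    simp only [HomCone.precomp, Category.assoc]
    rw [c.comm]

/-- The cone is universal: its apex is the limit `hom(A, X) ×_{hom(A, Y)} Y_k`. -/
def IsUniversal {M : C} (c : RelCone f A M) : Prop :=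
  ∀ (U : C) (t : RelCone f A U), ∃! g : U ⟶ M, c.precomp g = t

variable (f A) in
/-- The cone with apex `X_k` inducing the canonical map
`X_k → hom(A, X) ×_{hom(A, Y)} Y_k`. -/
def restriction : RelCone f A (X.obj (op ⦋k⦌)) where
  lift := HomCone.restriction X A
  base := f.app (op ⦋k⦌)
  comm _ := f.naturality _

/-- For `α : [l] → [k]` and `B ⊆ Δ^l` mapped into `A ⊆ Δ^k` by `α`, the induced map
`hom(A, X) ×_{hom(A, Y)} Y_k → hom(B, X) ×_{hom(B, Y)} Y_l`, on cones. -/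
def pull {U : C} (c : RelCone f A U) {l : ℕ} (α : ⦋l⦌ ⟶ ⦋k⦌)
    {B : (Δ[l] : SSet.{0}).Subcomplex} (h : B ≤ A.preimage (SSet.stdSimplex.map α)) :
    RelCone f B U where
  lift :=
    { π := fun {j} b => c.lift.π (j := j) ⟨(SSet.stdSimplex.map α).app (op j) b.1, h (op j) b.2⟩
      w := fun φ b => c.lift.w φ _ }
  base := c.base ≫ Y.map α.op
  comm {j} b := by
    have e := c.comm (j := j) ⟨(SSet.stdSimplex.map α).app (op j) b.1, h (op j) b.2⟩
    refine e.trans ?_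
    rw [Category.assoc, ← Y.map_comp]
    rfl

end RelCone

/-- The limit `hom(A, X)` exists and the restriction map `X_k → hom(A, X)` has property `Q`. -/
def RestrictionHas (Q : MorphismProperty C) (X : SimplicialObject C) {k : ℕ}
    (A : (Δ[k] : SSet.{0}).Subcomplex) : Prop :=
  ∃ (M : C) (c : HomCone (A : SSet.{0}) X M), c.IsUniversal ∧
    ∃ r : X.obj (op ⦋k⦌) ⟶ M, c.precomp r = HomCone.restriction X A ∧ Q r

/-- The limit `hom(A, X) ×_{hom(A, Y)} Y_k` exists and the canonical map from `X_k` to it has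
property `Q`. For `A = ∂Δ^k` this is the map `μ_k(f)` to the matching object, and for
`A = Λ^k_i` it is the map `λ^k_i(f)` to the object of relative horns. -/
def RelRestrictionHas (Q : MorphismProperty C) {X Y : SimplicialObject C} (f : X ⟶ Y) {k : ℕ}
    (A : (Δ[k] : SSet.{0}).Subcomplex) : Prop :=
  ∃ (M : C) (c : RelCone f A M), c.IsUniversal ∧
    ∃ r : X.obj (op ⦋k⦌) ⟶ M, c.precomp r = RelCone.restriction f A ∧ Q r

/-! ### Lie `n`-groupoids and `n`-hypercovers -/

/-- Lie `n`-groupoids, for `n ∈ ℕ ∪ {∞}`. -/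
structure IsLieGroupoid (W : MorphismProperty C) (n : ℕ∞) (X : SimplicialObject C) : Prop where
  cover : ∀ (k : ℕ) (i : Fin (k + 1)), 0 < k → RestrictionHas W X (SSet.horn k i)
  iso : ∀ (k : ℕ) (i : Fin (k + 1)), 0 < k → n < (k : ℕ∞) →
    RestrictionHas (MorphismProperty.isomorphisms C) X (SSet.horn k i)

/-- `n`-hypercovers, for `n ∈ ℕ ∪ {∞}`; a hypercover is an `∞`-hypercover. -/
structure IsHypercover (W : MorphismProperty C) (n : ℕ∞) {X Y : SimplicialObject C}
    (f : X ⟶ Y) : Prop where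
  source : IsLieGroupoid W ⊤ X
  target : IsLieGroupoid W ⊤ Y
  cover : ∀ k : ℕ, RelRestrictionHas W f (SSet.boundary k)
  iso : ∀ k : ℕ, n ≤ (k : ℕ∞) →
    RelRestrictionHas (MorphismProperty.isomorphisms C) f (SSet.boundary k)

/-! ### Higher morphism spaces and orbit spaces -/

/-- The ordinal sum of the identity of the `n`-element ordinal and of `φ`: the identity on the
first `n` elements, and `φ` on the remaining ones. -/
def ordinalSumMap (n : ℕ) {l m : ℕ} (φ : Fin (l + 1) →o Fin (m + 1)) :
    Fin (n + l + 1) →o Fin (n + m + 1) where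
  toFun i :=
    if h : i.val < n then ⟨i.val, by omega⟩
    else ⟨n + (φ ⟨i.val - n, by omega⟩).val, by omega⟩
  monotone' := by
    intro i j hij
    have hij' : i.val ≤ j.val := hij
    by_cases hi : i.val < n <;> by_cases hj : j.val < n
    · simpa [hi, hj] using hij
    · simp only [hi, hj, dite_true, dite_false, Fin.mk_le_mk]
      omega
    · omega
    · simp only [hi, hj, dite_false, Fin.mk_le_mk, add_le_add_iff_left, Fin.val_fin_le]
      exact φ.monotone (by simp only [Fin.mk_le_mk]; omega)

lemma ordinalSumMap_of_lt (n : ℕ) {l m : ℕ} (φ : Fin (l + 1) →o Fin (m + 1))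
    (i : Fin (n + l + 1)) (h : i.val < n) : (ordinalSumMap n φ i).val = i.val :=
  congrArg Fin.val (dif_pos h)

lemma ordinalSumMap_of_not_lt (n : ℕ) {l m : ℕ} (φ : Fin (l + 1) →o Fin (m + 1))
    (i : Fin (n + l + 1)) (h : ¬ i.val < n) :
    (ordinalSumMap n φ i).val = n + (φ ⟨i.val - n, by omega⟩).val :=
  congrArg Fin.val (dif_neg h)

lemma ordinalSumMap_id (n l : ℕ) :
    ordinalSumMap n (OrderHom.id : Fin (l + 1) →o Fin (l + 1)) = OrderHom.id := by
  ext i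
  by_cases h : i.val < n
  · simp [ordinalSumMap, h]
  · simp only [ordinalSumMap, OrderHom.coe_mk, h, dite_false, OrderHom.id_coe, id]
    omega

lemma ordinalSumMap_comp (n : ℕ) {l m p : ℕ} (φ : Fin (l + 1) →o Fin (m + 1))
    (ψ : Fin (m + 1) →o Fin (p + 1)) :
    ordinalSumMap n (ψ.comp φ) = (ordinalSumMap n ψ).comp (ordinalSumMap n φ) := by
  ext i
  rw [OrderHom.comp_coe, Function.comp_apply]
  by_cases h : i.val < n
  · rw [ordinalSumMap_of_lt n _ _ h, ordinalSumMap_of_lt n ψ, ordinalSumMap_of_lt n φ _ h]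
    rwa [ordinalSumMap_of_lt n φ _ h]
  · have e := ordinalSumMap_of_not_lt n φ i h
    rw [ordinalSumMap_of_not_lt n _ _ h, ordinalSumMap_of_not_lt n ψ _ (by omega)]
    simp [e]

/-- The functor `[l] ↦ [n-1] + [l] = [n+l]`, the ordinal sum with the `n`-element ordinal. -/
def ordinalSum (n : ℕ) : SimplexCategory ⥤ SimplexCategory where
  obj l := ⦋n + l.len⦌
  map φ := SimplexCategory.mkHom (ordinalSumMap n φ.toOrderHom)
  map_id l := congrArg SimplexCategory.mkHom (ordinalSumMap_id n l.len)
  map_comp φ ψ := congrArg SimplexCategory.mkHom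
    (ordinalSumMap_comp n φ.toOrderHom ψ.toOrderHom)

/-- The simplicial object `X^{Δ^{n-1} ⋆}`, whose `l`-simplices are
`hom(Δ^{n-1} ⋆ Δ^l, X) = X_{n+l}`; for `n = 0` it is `X`. -/
def dec (n : ℕ) (X : SimplicialObject C) : SimplicialObject C :=
  (ordinalSum n).op ⋙ X

/-- The identification of the vertices of `X^{Δ^{n-1} ⋆}` with `X_n`. -/
def decZero (n : ℕ) (X : SimplicialObject C) : (dec n X).obj (op ⦋0⦌) ⟶ X.obj (op ⦋n⦌) :=
  𝟙 (X.obj (op ⦋n⦌))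

/-- The simplicial subset `∂Δ^{n-1} ⋆ Δ^l` of `Δ^{n-1} ⋆ Δ^l = Δ^{n+l}`: the union of the faces
opposite to the vertices `0, …, n-1`. For `n = 0` it is empty. -/
def boundaryJoin (n l : ℕ) : (Δ[n + l] : SSet.{0}).Subcomplex :=
  ⨆ (i : Fin (n + l + 1)) (_ : i.val < n), SSet.stdSimplex.face {i}ᶜ

/-- The map `Δ^{n-1} ⋆ Δ^l → Δ^{n-1} ⋆ Δ^0` collapsing the second factor. -/
def collapse (n l : ℕ) : (⦋n + l⦌ : SimplexCategory) ⟶ ⦋n⦌ :=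
  SimplexCategory.mkHom
    { toFun := fun i => ⟨min i.val n, by omega⟩
      monotone' := by
        intro i j hij
        have hij' : i.val ≤ j.val := hij
        simp only [Fin.mk_le_mk]
        omega }

lemma boundaryJoin_le (n l : ℕ) :
    boundaryJoin n l ≤
      (SSet.horn.{0} n (Fin.last n)).preimage (SSet.stdSimplex.map (collapse n l)) := by
  refine iSup_le fun i => iSup_le fun hi => ?_
  rintro ⟨m⟩ x hx
  induction m using SimplexCategory.rec with
  | _ m =>
  have hx' : ∀ a : Fin (m + 1), x a ≠ i := by
    intro a
    simpa using (SSet.stdSimplex.mem_face_iff _ x).1 hx a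
  refine (SSet.mem_horn_iff_notMem_range _ _).2 ⟨⟨i.val, by omega⟩, ?_, ?_⟩
  · intro h
    have := congrArg Fin.val h
    simp at this
    omega
  · rintro ⟨a, ha⟩
    apply hx' a
    have h2 : min (x a).val n = i.val := congrArg Fin.val ha
    apply Fin.ext
    omega

/-- `ι : P → X^{Δ^{n-1} ⋆}` exhibits `P` as the relative higher morphism space `P^{≥ n}(f)`,
that is, as the pullback of the map
`X^{Δ^{n-1} ⋆} → X^{∂Δ^{n-1} ⋆} ×_{Y^{∂Δ^{n-1} ⋆}} Y^{Δ^{n-1} ⋆}` along the map from the constant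
simplicial object `Λ^n_n(f)`, the vertices of the target. The latter map is a monomorphism, so
the component `h` in `Λ^n_n(f)` is determined by the component `x` in `X^{Δ^{n-1} ⋆}`. -/
structure IsHigherMorphismSpace {X Y : SimplicialObject C} (f : X ⟶ Y) (n : ℕ)
    {P : SimplicialObject C} (ι : P ⟶ dec n X) : Prop where
  condition : ∀ l : ℕ,
    ∃ h : RelCone f (SSet.horn n (Fin.last n)) (P.obj (op ⦋l⦌)),
      (RelCone.restriction f (boundaryJoin n l)).precomp (ι.app (op ⦋l⦌)) =
        h.pull (collapse n l) (boundaryJoin_le n l)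
  universal : ∀ (l : ℕ) (U : C) (x : U ⟶ X.obj (op ⦋n + l⦌))
    (h : RelCone f (SSet.horn n (Fin.last n)) U),
    (RelCone.restriction f (boundaryJoin n l)).precomp x =
      h.pull (collapse n l) (boundaryJoin_le n l) →
    ∃! g : U ⟶ P.obj (op ⦋l⦌), g ≫ ι.app (op ⦋l⦌) = x

/-- `e : P_0 → Q` is an orbit space of `P`: a cover which is a coequalizer of the two face maps
`P_1 ⇉ P_0`. -/
structure IsOrbitSpace (W : MorphismProperty C) (P : SimplicialObject C) {Q : C}
    (e : P.obj (op ⦋0⦌) ⟶ Q) : Prop where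
  cover : W e
  coequalizer : ∃ w : P.δ (0 : Fin 2) ≫ e = P.δ (1 : Fin 2) ≫ e,
    Nonempty (IsColimit (Cofork.ofπ e w))

/-! ### Strictification and coskeleta -/

/-- `q : X → T` and `p : T → Y` exhibit `T` as the `n`-strictification `τ_n(X, f)` and `p` as
`τ_n(f)`. -/
structure IsStrictification (W : MorphismProperty C) (n : ℕ) {X Y T : SimplicialObject C}
    (f : X ⟶ Y) (q : X ⟶ T) (p : T ⟶ Y) : Prop where
  fac : q ≫ p = f
  /-- `T_k` is `X_k` for `k < n` -/
  iso_lt : ∀ k : ℕ, k < n → IsIso (q.app (op ⦋k⦌))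
  /-- `P^{≥ n}(f)` exists, and `X_n → T_n` is its orbit space -/
  orbit : ∃ (P : SimplicialObject C) (ι : P ⟶ dec n X), IsHigherMorphismSpace f n ι ∧
    IsOrbitSpace W P ((ι.app (op ⦋0⦌) ≫ decZero n X) ≫ q.app (op ⦋n⦌))
  /-- `T_{n+1}` is the object of relative horns `Λ^{n+1}_1(p)` -/
  horn : RelRestrictionHas (MorphismProperty.isomorphisms C) p (SSet.horn (n + 1) 1)
  /-- `T` is `Csk_{n+1} T ×_{Csk_{n+1} Y} Y`. -/
  coskeletal : ∀ k : ℕ, RelRestrictionHas (MorphismProperty.isomorphisms C) p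
    ((Δ[k] : SSet.{0}).skeleton (n + 2))

lemma skeleton_le (m : ℕ) {k l : ℕ} (α : (⦋l⦌ : SimplexCategory) ⟶ ⦋k⦌) :
    (Δ[l] : SSet.{0}).skeleton m ≤
      ((Δ[k] : SSet.{0}).skeleton m).preimage (SSet.stdSimplex.map α) := by
  refine iSup_le fun i => iSup_le fun x => ?_
  rw [SSet.Subcomplex.ofSimplex_le_iff]
  exact SSet.mem_skeleton _ _ i.isLt

/-- `q : X → Z` and `p : Z → Y` exhibit `Z` as the simplicial object
`Csk_{m-1} X ×_{Csk_{m-1} Y} Y`. Its `k`-simplices are the limit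
`hom(Sk_{m-1} Δ^k, X) ×_{hom(Sk_{m-1} Δ^k, Y)} Y_k`, with simplicial operators, projection to `Y`
and map from `X` the canonical ones; here `Δ[k].skeleton m` is the simplicial subset
`Sk_{m-1} Δ^k` generated by the simplices of dimension `< m`, which is empty for `m = 0`. -/
def IsRelCoskeleton (m : ℕ) {X Y Z : SimplicialObject C} (f : X ⟶ Y) (q : X ⟶ Z)
    (p : Z ⟶ Y) : Prop :=
  ∃ c : ∀ k : ℕ, RelCone f ((Δ[k] : SSet.{0}).skeleton m) (Z.obj (op ⦋k⦌)),
    (∀ k : ℕ, (c k).IsUniversal) ∧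
    (∀ (k l : ℕ) (α : (⦋l⦌ : SimplexCategory) ⟶ ⦋k⦌),
      (c l).precomp (Z.map α.op) = (c k).pull α (skeleton_le m α)) ∧
    (∀ k : ℕ, (c k).base = p.app (op ⦋k⦌)) ∧
    (∀ k : ℕ, (c k).precomp (q.app (op ⦋k⦌)) = RelCone.restriction f _)

end HigherStack

/-! The matching maps of a hypercover `f` are covers. Under this assumption a strictification is the
same as a factorization `f = q ≫ p` with `q` invertible in degrees `< n` and the matching maps of
`p` invertible in degrees `≥ n` (`IsRelTruncation`). Relative coskeleta are also the same as such
factorizations, so existence and the three claims are read off from them.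

The crux is degree `n`: the orbit space of `P^{≥ n}(f)` is `M_n(f)`
(`IsHigherMorphismSpace.isOrbitSpace`). Two `n`-simplices of `X` with the same image in `M_n(f)`
form, together with degenerate faces, a sphere over a degenerate simplex of `Y`. Since `X_{n+1} →
M_{n+1}(f)` is a cover, the sphere is filled after passing to a cover, and the filler lies in `P_1`.
Hence a map equalizing `P_1 ⇉ P_0` equalizes the kernel pair of `X_n → M_n(f)`, and so descends
along this cover. As `q` is invertible below `n`, `M_n(f) = M_n(p)`; thus `T_n ≅ M_n(p)`. The horn
condition in degree `n + 1` and coskeletality above give the other degrees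
(`isUniversal_restriction_boundary`).

All limits come from `RepresentsLifts.extend`: attaching a cell amounts to pulling back a matching
map. Applied to covers this gives existence and the cover property; applied to isomorphisms it gives
unique extension. -/

namespace HigherStack

variable {C : Type u} [Category.{v} C] {X Y T : SimplicialObject C} {k : ℕ}
  {A B S : (Δ[k] : SSet.{0}).Subcomplex} {U V M : C} {i j : SimplexCategory}

/-! ### Simplicial subsets of a standard simplex, as sets of morphisms -/

/-- A simplex of `Δ^k`, given as a morphism of the simplex category, belongs to `A`. -/
def Mem (A : (Δ[k] : SSet.{0}).Subcomplex) {j : SimplexCategory} (φ : j ⟶ ⦋k⦌) : Prop :=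
  SSet.stdSimplex.objEquiv.symm φ ∈ A.obj (op j)

lemma Mem.comp {φ : j ⟶ ⦋k⦌} (h : Mem A φ) (ψ : i ⟶ j) : Mem A (ψ ≫ φ) :=
  A.map ψ.op h

/-- Epimorphisms of the simplex category split, so a degeneracy of a simplex determines it. -/
lemma Mem.of_epi {φ : j ⟶ ⦋k⦌} (e : i ⟶ j) [Epi e] (h : Mem A (e ≫ φ)) : Mem A φ := by
  have := isSplitEpi_of_epi e
  simpa using h.comp (section_ e)

lemma Mem.mono {φ : j ⟶ ⦋k⦌} (h : Mem A φ) (hAB : A ≤ B) : Mem B φ :=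
  hAB (op j) h

lemma not_mem_bot (φ : j ⟶ ⦋k⦌) : ¬ Mem ⊥ φ := fun h => h

lemma exists_epi_mono_fac (φ : j ⟶ ⦋k⦌) :
    ∃ (i : SimplexCategory) (e : j ⟶ i) (τ : i ⟶ ⦋k⦌), Epi e ∧ Mono τ ∧ φ = e ≫ τ :=
  ⟨image φ, factorThruImage φ, image.ι φ, inferInstance, inferInstance, (image.fac φ).symm⟩

lemma le_of_mem (h : ∀ (j : SimplexCategory) (φ : j ⟶ ⦋k⦌), Mem A φ → Mem B φ) : A ≤ B := by
  intro j x hx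
  exact h j.unop (SSet.stdSimplex.objEquiv x) hx

lemma le_of_mono_mem
    (h : ∀ (j : SimplexCategory) (φ : j ⟶ ⦋k⦌), Mono φ → Mem A φ → Mem B φ) : A ≤ B := by
  refine le_of_mem fun j φ hφ => ?_
  obtain ⟨i, e, τ, he, hτ, rfl⟩ := exists_epi_mono_fac φ
  exact (h i τ hτ hφ.of_epi).comp e

lemma mem_preimage {l : ℕ} {α : (⦋l⦌ : SimplexCategory) ⟶ ⦋k⦌} (φ : j ⟶ ⦋l⦌) :
    Mem (A.preimage (SSet.stdSimplex.map α)) φ ↔ Mem A (φ ≫ α) := Iff.rfl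

lemma mem_boundary {φ : j ⟶ ⦋k⦌} :
    Mem (SSet.boundary k) φ ↔ ∃ i, ∀ a, φ.toOrderHom a ≠ i := by
  induction j using SimplexCategory.rec with | _ j =>
  refine (SSet.mem_boundary_iff_notMem_range _).trans ?_
  simp only [Set.mem_range, not_exists]
  rfl

lemma mem_horn {φ : j ⟶ ⦋k⦌} {i₀ : Fin (k + 1)} :
    Mem (SSet.horn k i₀) φ ↔ ∃ i, i ≠ i₀ ∧ ∀ a, φ.toOrderHom a ≠ i := by
  induction j using SimplexCategory.rec with | _ j =>
  refine (SSet.mem_horn_iff_notMem_range _ _).trans ?_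
  simp only [Set.mem_range, not_exists, exists_prop]
  rfl

lemma mem_boundaryJoin {n l : ℕ} {φ : j ⟶ ⦋n + l⦌} :
    Mem (boundaryJoin n l) φ ↔ ∃ i : Fin (n + l + 1), i.val < n ∧ ∀ a, φ.toOrderHom a ≠ i := by
  induction j using SimplexCategory.rec with | _ j =>
  simp only [Mem, boundaryJoin, Subfunctor.iSup_obj, Set.mem_iUnion, exists_prop]
  refine exists_congr fun i => and_congr_right fun _ => ?_
  rw [SSet.stdSimplex.mem_face_iff]
  simp only [Finset.mem_compl, Finset.mem_singleton]
  rfl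

lemma mem_skeleton_of_lt {m : ℕ} (φ : j ⟶ ⦋k⦌) (h : j.len < m) :
    Mem ((Δ[k] : SSet.{0}).skeleton m) φ := by
  induction j using SimplexCategory.rec with | _ j =>
  exact SSet.mem_skeleton _ _ h

lemma mem_skeleton_iff {m : ℕ} {φ : j ⟶ ⦋k⦌} :
    Mem ((Δ[k] : SSet.{0}).skeleton m) φ ↔
      ∃ i : ℕ, i < m ∧ ∃ (e : j ⟶ ⦋i⦌) (τ : ⦋i⦌ ⟶ ⦋k⦌), φ = e ≫ τ := by
  constructor
  · intro h
    change SSet.stdSimplex.objEquiv.symm φ ∈ (⨆ (i : Fin m)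
      (x : (Δ[k] : SSet.{0}).nonDegenerate i), SSet.Subcomplex.ofSimplex x.1).obj (op j) at h
    simp only [Subfunctor.iSup_obj, Set.mem_iUnion] at h
    obtain ⟨i, x, e, he⟩ := h
    exact ⟨i, i.isLt, e.unop, SSet.stdSimplex.objEquiv x.1,
      (SSet.stdSimplex.objEquiv.symm.injective he).symm⟩
  · rintro ⟨i, hi, e, τ, rfl⟩
    exact (mem_skeleton_of_lt τ hi).comp e

lemma len_lt_of_mem_skeleton {m : ℕ} {φ : j ⟶ ⦋k⦌} [Mono φ]
    (h : Mem ((Δ[k] : SSet.{0}).skeleton m) φ) : j.len < m := by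
  obtain ⟨i, hi, e, τ, rfl⟩ := mem_skeleton_iff.1 h
  have : Mono e := mono_of_mono e τ
  exact (SimplexCategory.len_le_of_mono e).trans_lt hi

lemma mem_boundary_iff_not_epi {φ : j ⟶ ⦋k⦌} : Mem (SSet.boundary k) φ ↔ ¬ Epi φ := by
  rw [mem_boundary, SimplexCategory.epi_iff_surjective, Function.Surjective]
  push Not
  rfl

lemma mem_boundary_of_lt (φ : j ⟶ ⦋k⦌) (h : j.len < k) : Mem (SSet.boundary k) φ := by
  rw [mem_boundary_iff_not_epi]
  intro _
  exact absurd (SimplexCategory.len_le_of_epi φ) (by simpa using h)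

lemma len_lt_of_mem_boundary {φ : j ⟶ ⦋k⦌} [Mono φ] (h : Mem (SSet.boundary k) φ) :
    j.len < k := by
  refine lt_of_le_of_ne (SimplexCategory.len_le_of_mono φ) fun e => ?_
  rw [mem_boundary_iff_not_epi] at h
  have := (SimplexCategory.isIso_iff_of_mono φ).2 e
  exact h inferInstance

lemma skeleton_le_boundary {m : ℕ} (h : m ≤ k) :
    (Δ[k] : SSet.{0}).skeleton m ≤ SSet.boundary k :=
  le_of_mono_mem fun _ φ _ hφ =>
    mem_boundary_of_lt φ ((len_lt_of_mem_skeleton hφ).trans_le h)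

lemma boundary_le_skeleton {m : ℕ} (h : k ≤ m) :
    SSet.boundary k ≤ (Δ[k] : SSet.{0}).skeleton m :=
  le_of_mono_mem fun _ φ _ hφ =>
    mem_skeleton_of_lt φ ((len_lt_of_mem_boundary hφ).trans_le h)

lemma skeleton_eq_top {m : ℕ} (h : k < m) : (Δ[k] : SSet.{0}).skeleton m = ⊤ :=
  top_le_iff.1 (le_of_mono_mem fun _ φ _ _ =>
    mem_skeleton_of_lt φ ((SimplexCategory.len_le_of_mono φ).trans_lt h))

lemma horn_le_boundary (i₀ : Fin (k + 1)) : SSet.horn k i₀ ≤ SSet.boundary.{0} k :=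
  le_of_mem fun _ _ h => by
    obtain ⟨i, -, hi⟩ := mem_horn.1 h
    exact mem_boundary.2 ⟨i, hi⟩

/-- Such a simplex misses at least two of the `k + 2` vertices, hence one different from `i₀`. -/
lemma mem_horn_of_lt (i₀ : Fin (k + 2)) (φ : j ⟶ ⦋k + 1⦌) (h : j.len < k) :
    Mem (SSet.horn (k + 1) i₀) φ := by
  induction j using SimplexCategory.rec with | _ j =>
  rw [Mem, SSet.horn_obj_eq_univ i₀ j (Nat.succ_lt_succ h)]
  trivial

/-! ### Cones over simplicial subsets of a standard simplex -/

namespace HomCone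

/-- The component of a cone at a simplex given as a morphism of the simplex category. -/
def at' (c : HomCone (A : SSet.{0}) X U) (φ : j ⟶ ⦋k⦌) (h : Mem A φ) : U ⟶ X.obj (op j) :=
  c.π (j := j) ⟨SSet.stdSimplex.objEquiv.symm φ, h⟩

lemma at'_comp (c : HomCone (A : SSet.{0}) X U) (φ : j ⟶ ⦋k⦌) (h : Mem A φ) (ψ : i ⟶ j) :
    c.at' φ h ≫ X.map ψ.op = c.at' (ψ ≫ φ) (h.comp ψ) :=
  c.w ψ _

lemma at'_congr (c : HomCone (A : SSet.{0}) X U) {φ φ' : j ⟶ ⦋k⦌} (e : φ = φ') (h : Mem A φ)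
    (h' : Mem A φ') : c.at' φ h = c.at' φ' h' := by
  subst e; rfl

lemma ext' {c c' : HomCone (A : SSet.{0}) X U}
    (h : ∀ (j : SimplexCategory) (φ : j ⟶ ⦋k⦌) (hφ : Mem A φ), c.at' φ hφ = c'.at' φ hφ) :
    c = c' := by
  refine HomCone.ext ?_
  funext j a
  exact h j (SSet.stdSimplex.objEquiv a.1) a.2

/-- Degenerate simplices add nothing; this keeps the dimensions to be checked bounded. -/
lemma ext_of_mono {c c' : HomCone (A : SSet.{0}) X U}
    (h : ∀ (j : SimplexCategory) (φ : j ⟶ ⦋k⦌) (hφ : Mem A φ), Mono φ →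
      c.at' φ hφ = c'.at' φ hφ) : c = c' := by
  refine ext' fun j φ hφ => ?_
  obtain ⟨i, e, τ, he, hτ, rfl⟩ := exists_epi_mono_fac φ
  rw [← c.at'_comp τ hφ.of_epi, ← c'.at'_comp τ hφ.of_epi, h _ _ _ hτ]

/-- Constructor for cones from families indexed by morphisms of the simplex category. -/
def ofFamily (F : ∀ {j : SimplexCategory} (φ : j ⟶ ⦋k⦌), Mem A φ → (U ⟶ X.obj (op j)))
    (hF : ∀ {i j : SimplexCategory} (ψ : i ⟶ j) (φ : j ⟶ ⦋k⦌) (h : Mem A φ),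
      F φ h ≫ X.map ψ.op = F (ψ ≫ φ) (h.comp ψ)) : HomCone (A : SSet.{0}) X U where
  π {_} a := F (SSet.stdSimplex.objEquiv a.1) a.2
  w ψ a := hF ψ (SSet.stdSimplex.objEquiv a.1) a.2

@[simp]
lemma ofFamily_at' (F : ∀ {j : SimplexCategory} (φ : j ⟶ ⦋k⦌), Mem A φ → (U ⟶ X.obj (op j)))
    (hF : ∀ {i j : SimplexCategory} (ψ : i ⟶ j) (φ : j ⟶ ⦋k⦌) (h : Mem A φ),
      F φ h ≫ X.map ψ.op = F (ψ ≫ φ) (h.comp ψ)) (φ : j ⟶ ⦋k⦌) (h : Mem A φ) :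
    (ofFamily F hF).at' φ h = F φ h := rfl

@[simp]
lemma precomp_at' (c : HomCone (A : SSet.{0}) X U) (g : V ⟶ U) (φ : j ⟶ ⦋k⦌) (h : Mem A φ) :
    (c.precomp g).at' φ h = g ≫ c.at' φ h := rfl

@[simp]
lemma restriction_at' (φ : j ⟶ ⦋k⦌) (h : Mem A φ) :
    (restriction X A).at' φ h = X.map φ.op := rfl

/-- Restriction of a cone to a smaller simplicial subset. -/
def restrict (c : HomCone (B : SSet.{0}) X U) (hAB : A ≤ B) : HomCone (A : SSet.{0}) X U where
  π {j} a := c.π (j := j) ⟨a.1, hAB _ a.2⟩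
  w φ _ := c.w φ _

/-- The image of a cone under a map of simplicial objects. -/
def postcomp (c : HomCone (A : SSet.{0}) X U) (f : X ⟶ Y) : HomCone (A : SSet.{0}) Y U where
  π a := c.π a ≫ f.app _
  w φ a := by rw [Category.assoc, ← f.naturality, ← Category.assoc, c.w]

@[simp]
lemma postcomp_at' (c : HomCone (A : SSet.{0}) X U) (f : X ⟶ Y) (φ : j ⟶ ⦋k⦌) (h : Mem A φ) :
    (c.postcomp f).at' φ h = c.at' φ h ≫ f.app _ := rfl

lemma precomp_postcomp (c : HomCone (A : SSet.{0}) X U) (f : X ⟶ Y) (g : V ⟶ U) :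
    (c.precomp g).postcomp f = (c.postcomp f).precomp g :=
  ext' fun _ _ _ => by simp

lemma precomp_comp (c : HomCone (A : SSet.{0}) X U) (g : V ⟶ U) (h : M ⟶ V) :
    c.precomp (h ≫ g) = (c.precomp g).precomp h :=
  ext' fun _ _ _ => by simp

lemma precomp_id (c : HomCone (A : SSet.{0}) X U) : c.precomp (𝟙 U) = c :=
  ext' fun _ _ _ => by simp

end HomCone

namespace RelCone

variable {f : X ⟶ Y}

lemma ext' {c c' : RelCone f A U} (hb : c.base = c'.base)
    (h : ∀ (j : SimplexCategory) (φ : j ⟶ ⦋k⦌) (hφ : Mem A φ),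
      c.lift.at' φ hφ = c'.lift.at' φ hφ) : c = c' :=
  RelCone.ext (HomCone.ext' h) hb

lemma comm_at' (c : RelCone f A U) (φ : j ⟶ ⦋k⦌) (h : Mem A φ) :
    c.lift.at' φ h ≫ f.app (op j) = c.base ≫ Y.map φ.op :=
  c.comm (j := j) _

/-- Constructor for relative cones. -/
def mk' (lift : HomCone (A : SSet.{0}) X U) (base : U ⟶ Y.obj (op ⦋k⦌))
    (h : ∀ (j : SimplexCategory) (φ : j ⟶ ⦋k⦌) (hφ : Mem A φ),
      lift.at' φ hφ ≫ f.app (op j) = base ≫ Y.map φ.op) : RelCone f A U where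
  lift := lift
  base := base
  comm {j} a := h j (SSet.stdSimplex.objEquiv a.1) a.2

@[simp]
lemma precomp_lift (c : RelCone f A U) (g : V ⟶ U) : (c.precomp g).lift = c.lift.precomp g := rfl

@[simp]
lemma precomp_base (c : RelCone f A U) (g : V ⟶ U) : (c.precomp g).base = g ≫ c.base := rfl

@[simp]
lemma restriction_lift : (restriction f A).lift = HomCone.restriction X A := rfl

@[simp]
lemma restriction_base : (restriction f A).base = f.app (op ⦋k⦌) := rfl

@[simp]
lemma pull_base (c : RelCone f A U) {l : ℕ} (α : ⦋l⦌ ⟶ ⦋k⦌) {B : (Δ[l] : SSet.{0}).Subcomplex}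
    (h : B ≤ A.preimage (SSet.stdSimplex.map α)) : (c.pull α h).base = c.base ≫ Y.map α.op := rfl

@[simp]
lemma pull_lift_at' (c : RelCone f A U) {l : ℕ} (α : ⦋l⦌ ⟶ ⦋k⦌)
    {B : (Δ[l] : SSet.{0}).Subcomplex} (h : B ≤ A.preimage (SSet.stdSimplex.map α))
    (φ : j ⟶ ⦋l⦌) (hφ : Mem B φ) :
    (c.pull α h).lift.at' φ hφ = c.lift.at' (φ ≫ α) (mem_preimage φ |>.1 (hφ.mono h)) := rfl

lemma precomp_comp (c : RelCone f A U) (g : V ⟶ U) (h : M ⟶ V) :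
    c.precomp (h ≫ g) = (c.precomp g).precomp h :=
  ext' (by simp) fun _ _ _ => by simp

lemma precomp_id (c : RelCone f A U) : c.precomp (𝟙 U) = c :=
  ext' (by simp) fun _ _ _ => by simp

/-- Restriction of a relative cone to a smaller simplicial subset. -/
def restrict (c : RelCone f B U) (hAB : A ≤ B) : RelCone f A U :=
  mk' (c.lift.restrict hAB) c.base fun _ φ hφ => c.comm_at' φ (hφ.mono hAB)

lemma IsUniversal.hom_ext {c : RelCone f A M} (hc : c.IsUniversal) {g h : U ⟶ M}
    (e : c.precomp g = c.precomp h) : g = h :=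
  (hc U (c.precomp h)).unique e rfl

end RelCone

/-- `X_k` itself can serve as the limit, so an invertible restriction map becomes a unique extension
property. -/
lemma relRestrictionHas_isomorphisms_iff {f : X ⟶ Y} :
    RelRestrictionHas (MorphismProperty.isomorphisms C) f A ↔
      (RelCone.restriction f A).IsUniversal := by
  constructor
  · rintro ⟨M, c, hc, r, hr, hi⟩ U t
    rw [MorphismProperty.isomorphisms.iff] at hi
    obtain ⟨g, hg, -⟩ := hc U t
    refine ⟨g ≫ inv r, ?_, fun g' hg' => ?_⟩
    · dsimp only
      rw [← hr, ← RelCone.precomp_comp]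
      simpa using hg
    · rw [IsIso.eq_comp_inv]
      apply hc.hom_ext
      rw [hg, RelCone.precomp_comp, hr, hg']
  · intro h
    exact ⟨_, _, h, 𝟙 _, RelCone.precomp_id _, inferInstanceAs (IsIso (𝟙 _))⟩

end HigherStack

namespace HigherStack

variable {C : Type u} [Category.{v} C] {X Y T : SimplicialObject C} {f : X ⟶ Y} {k : ℕ}
  {A B S : (Δ[k] : SSet.{0}).Subcomplex} {U V M : C} {i j : SimplexCategory}
  {Q W : MorphismProperty C}

/-! ### Extending lifts along attachments of cells -/

/-- A class of morphisms closed under composition, along which pullbacks exist, and which is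
stable under base change. -/
structure IsPullbackClass (Q : MorphismProperty C) : Prop where
  isMultiplicative : Q.IsMultiplicative
  hasPullback : ∀ {X Y Z : C} (f : X ⟶ Z) (g : Y ⟶ Z), Q f → HasPullback f g
  isStableUnderBaseChange : Q.IsStableUnderBaseChange

lemma IsCoverClass.isPullbackClass (hW : IsCoverClass W) : IsPullbackClass W :=
  ⟨hW.1, hW.3, hW.4⟩

-- The second class, besides covers, to which the cell attachment arguments are applied.
variable (C) in
lemma isPullbackClass_isomorphisms : IsPullbackClass (MorphismProperty.isomorphisms C) where
  isMultiplicative := inferInstance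
  hasPullback f g hf := by
    have : IsIso f := hf
    exact hasPullback_of_left_iso f g
  isStableUnderBaseChange := inferInstance

/-- The cone `c` in `X` lifts the restriction along `b` of the cone `D` in `Y`, wherever both
are defined. -/
def IsLift (f : X ⟶ Y) (D : HomCone (S : SSet.{0}) Y V) (b : U ⟶ V)
    (c : HomCone (A : SSet.{0}) X U) : Prop :=
  ∀ ⦃j : SimplexCategory⦄ (φ : j ⟶ ⦋k⦌) (hA : Mem A φ) (hS : Mem S φ),
    c.at' φ hA ≫ f.app (op j) = b ≫ D.at' φ hS

lemma IsLift.precomp {D : HomCone (S : SSet.{0}) Y V} {b : U ⟶ V}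
    {c : HomCone (A : SSet.{0}) X U} (h : IsLift f D b c) (g : M ⟶ U) :
    IsLift f D (g ≫ b) (c.precomp g) := fun j φ hA hS => by
  simp [h φ hA hS]

lemma IsLift.restrict {D : HomCone (S : SSet.{0}) Y V} {b : U ⟶ V}
    {c : HomCone (B : SSet.{0}) X U} (h : IsLift f D b c) (hAB : A ≤ B) :
    IsLift f D b (c.restrict hAB) := fun _ φ hA hS => h φ (hA.mono hAB) hS

/-- The object `M` over `V`, with the cone `c`, represents the lifts to `X` over `A` of the
cone `D` in `Y`. -/
structure RepresentsLifts (f : X ⟶ Y) (D : HomCone (S : SSet.{0}) Y V) (m : M ⟶ V)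
    (c : HomCone (A : SSet.{0}) X M) : Prop where
  isLift : IsLift f D m c
  exists_lift : ∀ {U : C} (b : U ⟶ V) (t : HomCone (A : SSet.{0}) X U), IsLift f D b t →
    ∃ g : U ⟶ M, g ≫ m = b ∧ c.precomp g = t
  hom_ext : ∀ {U : C} {g h : U ⟶ M}, g ≫ m = h ≫ m → c.precomp g = c.precomp h → g = h

/-- If `A'` is obtained from `A` by attaching a single cell `σ` along its boundary, the lifts
over `A'` are represented by a pullback of the matching map of `f`. -/
lemma RepresentsLifts.attach_cell (hQ : IsPullbackClass Q)
    {D : HomCone (S : SSet.{0}) Y V} {m : M ⟶ V} {c : HomCone (A : SSet.{0}) X M}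
    (hc : RepresentsLifts f D m c) {d : ℕ} (σ : ⦋d⦌ ⟶ ⦋k⦌) [Mono σ]
    (hf : RelRestrictionHas Q f (SSet.boundary d)) (hσA : ¬ Mem A σ) (hσS : Mem S σ)
    (hbd : ∀ ⦃j : SimplexCategory⦄ (ψ : j ⟶ ⦋d⦌), ¬ Epi ψ → Mem A (ψ ≫ σ))
    (hAB : A ≤ B) (hσB : Mem B σ)
    (hB : ∀ ⦃j : SimplexCategory⦄ (φ : j ⟶ ⦋k⦌), Mem B φ →
      Mem A φ ∨ ∃ ψ : j ⟶ ⦋d⦌, φ = ψ ≫ σ) :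
    ∃ (N : C) (n : N ⟶ V) (c' : HomCone (B : SSet.{0}) X N) (r : N ⟶ M),
      RepresentsLifts f D n c' ∧ Q r ∧ r ≫ m = n ∧ c.precomp r = c'.restrict hAB := by
  obtain ⟨K, κ, hκ, μ, hμ, hμQ⟩ := hf
  -- The cell meets `A` only in its boundary: an epimorphism `ψ` splits, so `ψ ≫ σ` in `A` would put
  -- `σ` in `A`.
  have hnotA : ∀ ⦃j : SimplexCategory⦄ (ψ : j ⟶ ⦋d⦌), Mem A (ψ ≫ σ) →
      Mem (SSet.boundary d) ψ := fun j ψ h =>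
    mem_boundary_iff_not_epi.2 fun _ => hσA h.of_epi
  -- The values of `c` on `∂σ` and the simplex `D(σ)` of `Y` form a point of the matching object
  -- `K`; the new representing object is the pullback of `X_d → K` along the classifying map `g`.
  let β : RelCone f (SSet.boundary d) M := RelCone.mk'
    (HomCone.ofFamily
      (fun ψ hψ => c.at' (ψ ≫ σ) (hbd ψ (mem_boundary_iff_not_epi.1 hψ)))
      (fun ψ φ h => by
        rw [c.at'_comp]
        exact c.at'_congr (Category.assoc _ _ _).symm _ _))
    (m ≫ D.at' σ hσS)
    (fun j ψ hψ => by
      rw [HomCone.ofFamily_at', hc.isLift _ _ (hσS.comp ψ), Category.assoc, D.at'_comp])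
  obtain ⟨g, hg, -⟩ := hκ M β
  have : HasPullback μ g := hQ.hasPullback μ g hμQ
  have : Q.IsStableUnderBaseChange := hQ.isStableUnderBaseChange
  have hgμ : ∀ ⦃j : SimplexCategory⦄ (ψ : j ⟶ ⦋d⦌) (h : Mem A (ψ ≫ σ)),
      pullback.fst μ g ≫ X.map ψ.op = pullback.snd μ g ≫ c.at' (ψ ≫ σ) h := fun j ψ h => by
    have e := congrArg (fun t => t.lift.at' ψ (hnotA ψ h))
      ((κ.precomp_comp _ _).symm.trans ((congrArg κ.precomp (pullback.condition (f := μ)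
        (g := g))).trans (κ.precomp_comp _ _)))
    rw [hμ, hg] at e
    exact e
  have hgμY : pullback.fst μ g ≫ f.app (op ⦋d⦌) = pullback.snd μ g ≫ m ≫ D.at' σ hσS := by
    have e := congrArg RelCone.base
      ((κ.precomp_comp _ _).symm.trans ((congrArg κ.precomp (pullback.condition (f := μ)
        (g := g))).trans (κ.precomp_comp _ _)))
    rw [hμ, hg] at e
    exact e
  classical
  -- Off `A`, the factorization of `φ` through `σ` is unique because `σ` is mono; on the overlap the
  -- two prescriptions agree by the pullback square.
  let c' : HomCone (B : SSet.{0}) X (pullback μ g) := HomCone.ofFamily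
    (fun φ hφ => if h : Mem A φ then pullback.snd μ g ≫ c.at' φ h
      else pullback.fst μ g ≫ X.map ((hB φ hφ).resolve_left h).choose.op)
    (fun {i j} ψ φ hφ => by
      by_cases h : Mem A φ
      · rw [dif_pos h, dif_pos (h.comp ψ), Category.assoc, c.at'_comp]
      · rw [dif_neg h]
        have hχ := ((hB φ hφ).resolve_left h).choose_spec
        set χ := ((hB φ hφ).resolve_left h).choose
        by_cases h' : Mem A (ψ ≫ φ)
        · have e : ψ ≫ φ = (ψ ≫ χ) ≫ σ := by rw [Category.assoc, ← hχ]
          rw [dif_pos h', c.at'_congr e h' (e ▸ h'), ← hgμ, Category.assoc, ← X.map_comp]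
          rfl
        · rw [dif_neg h']
          have hχ' := ((hB _ (hφ.comp ψ)).resolve_left h').choose_spec
          set χ' := ((hB _ (hφ.comp ψ)).resolve_left h').choose
          have e : χ' = ψ ≫ χ := by
            rw [← cancel_mono σ, ← hχ', Category.assoc, ← hχ]
          rw [e, op_comp, X.map_comp, Category.assoc])
  have hc'A : ∀ ⦃j : SimplexCategory⦄ (φ : j ⟶ ⦋k⦌) (hφ : Mem B φ) (h : Mem A φ),
      c'.at' φ hφ = pullback.snd μ g ≫ c.at' φ h := fun j φ hφ h => dif_pos h
  have hc'σ : ∀ ⦃j : SimplexCategory⦄ (ψ : j ⟶ ⦋d⦌),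
      c'.at' (ψ ≫ σ) (hσB.comp ψ) = pullback.fst μ g ≫ X.map ψ.op := fun j ψ => by
    by_cases h : Mem A (ψ ≫ σ)
    · rw [hc'A _ _ h, hgμ ψ h]
    · refine (dif_neg h).trans ?_
      have hχ := ((hB _ (hσB.comp ψ)).resolve_left h).choose_spec
      exact congrArg (fun χ => pullback.fst μ g ≫ X.map χ.op) ((cancel_mono σ).1 hχ.symm)
  refine ⟨_, pullback.snd μ g ≫ m, c', pullback.snd μ g, ⟨?_, ?_, ?_⟩,
    MorphismProperty.pullback_snd _ _ hμQ, rfl, ?_⟩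
  · intro j φ hφ hS
    by_cases h : Mem A φ
    · rw [hc'A φ hφ h, Category.assoc, hc.isLift φ h hS, Category.assoc]
    · obtain ⟨ψ, rfl⟩ := (hB φ hφ).resolve_left h
      rw [hc'σ, Category.assoc, f.naturality, ← Category.assoc, hgμY]
      simp only [Category.assoc]
      rw [D.at'_comp]
  · intro U b t ht
    obtain ⟨g₁, hg₁, hg₁'⟩ := hc.exists_lift b (t.restrict hAB) (ht.restrict hAB)
    have hat : ∀ ⦃j : SimplexCategory⦄ (φ : j ⟶ ⦋k⦌) (h : Mem A φ),
        g₁ ≫ c.at' φ h = t.at' φ (h.mono hAB) := fun j φ h =>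
      congrArg (fun t => t.at' φ h) hg₁'
    have e : t.at' σ hσB ≫ μ = g₁ ≫ g := by
      apply hκ.hom_ext
      rw [κ.precomp_comp, κ.precomp_comp, hμ, hg]
      refine RelCone.ext' ?_ fun j ψ hψ => ?_
      · change t.at' σ hσB ≫ f.app _ = g₁ ≫ m ≫ D.at' σ hσS
        rw [ht _ _ hσS, ← hg₁, Category.assoc]
      · change t.at' σ hσB ≫ X.map ψ.op = g₁ ≫ c.at' (ψ ≫ σ) _
        rw [t.at'_comp]
        exact (hat _ _).symm
    refine ⟨pullback.lift _ _ e, by rw [pullback.lift_snd_assoc, hg₁], HomCone.ext' fun j φ hφ => ?_⟩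
    rw [HomCone.precomp_at']
    by_cases h : Mem A φ
    · rw [hc'A φ hφ h, pullback.lift_snd_assoc, hat]
    · obtain ⟨ψ, rfl⟩ := (hB φ hφ).resolve_left h
      rw [hc'σ, pullback.lift_fst_assoc, t.at'_comp]
  · intro U g₁ g₂ e₁ e₂
    have hat : ∀ ⦃j : SimplexCategory⦄ (φ : j ⟶ ⦋k⦌) (h : Mem B φ),
        g₁ ≫ c'.at' φ h = g₂ ≫ c'.at' φ h := fun j φ h => congrArg (fun t => t.at' φ h) e₂
    apply pullback.hom_ext
    · have e := hat _ (hσB.comp (𝟙 _))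
      rw [hc'σ] at e
      simpa using e
    · apply hc.hom_ext
      · simpa using e₁
      · refine HomCone.ext' fun j φ h => ?_
        have e := hat φ (h.mono hAB)
        rw [hc'A _ _ h] at e
        simpa using e
  · exact HomCone.ext' fun j φ h => (hc'A φ (h.mono hAB) h).symm

/-- If lifts over `A` are represented by `M`, lifts over `B ⊇ A` are represented by an object
`N`, and `N ⟶ M` is in the class `Q` as soon as the matching maps of `f` for the missing cells
are. -/
theorem RepresentsLifts.extend (hQ : IsPullbackClass Q)
    {D : HomCone (S : SSet.{0}) Y V} {m : M ⟶ V} {c : HomCone (A : SSet.{0}) X M}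
    (hc : RepresentsLifts f D m c) (hAB : A ≤ B) (hBS : B ≤ S)
    (hf : ∀ (d : ℕ) (σ : ⦋d⦌ ⟶ ⦋k⦌), Mono σ → Mem B σ → ¬ Mem A σ →
      RelRestrictionHas Q f (SSet.boundary d)) :
    ∃ (N : C) (n : N ⟶ V) (c' : HomCone (B : SSet.{0}) X N) (r : N ⟶ M),
      RepresentsLifts f D n c' ∧ Q r ∧ r ≫ m = n ∧ c.precomp r = c'.restrict hAB := by
  have := hQ.isMultiplicative
  -- Induction on the number of missing nondegenerate cells; the bound `Fin (k + 1)` makes this set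
  -- finite.
  let cells (A : (Δ[k] : SSet.{0}).Subcomplex) : 
      Set (Σ d : Fin (k + 1), (⦋d.1⦌ : SimplexCategory) ⟶ ⦋k⦌) :=
    {x | Mono x.2 ∧ Mem B x.2 ∧ ¬ Mem A x.2}
  induction h : (cells A).ncard using Nat.strong_induction_on generalizing A M with
  | _ N ih =>
  by_cases hBA : B ≤ A
  · obtain rfl := le_antisymm hAB hBA
    exact ⟨M, m, c, 𝟙 M, hc, Q.id_mem M, Category.id_comp m, c.precomp_id⟩
  have hex : ∃ d : ℕ, ∃ σ : ⦋d⦌ ⟶ ⦋k⦌, Mono σ ∧ Mem B σ ∧ ¬ Mem A σ := by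
    by_contra hne
    push Not at hne
    exact hBA (le_of_mono_mem fun j φ hφ hB => hne j.len φ hφ hB)
  classical
  -- A missing cell of least dimension has its whole boundary in `A`, so it can be attached.
  let d := Nat.find hex
  obtain ⟨σ, hσ, hσB, hσA⟩ := Nat.find_spec hex
  have hmin : ∀ ⦃j : SimplexCategory⦄ (φ : j ⟶ ⦋k⦌), Mono φ → j.len < d → Mem B φ → Mem A φ := by
    intro j φ hφ hj hB
    by_contra hA
    exact Nat.find_min hex hj ⟨φ, hφ, hB, hA⟩
  let A' : (Δ[k] : SSet.{0}).Subcomplex :=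
    A ⊔ SSet.Subcomplex.ofSimplex (SSet.stdSimplex.objEquiv.symm σ)
  have hAA' : A ≤ A' := le_sup_left
  have hσA' : Mem A' σ := (le_sup_right : _ ≤ A') _ (SSet.Subcomplex.mem_ofSimplex_obj _)
  have hA'B : A' ≤ B := sup_le hAB ((SSet.Subcomplex.ofSimplex_le_iff _ _).2 hσB)
  have hbd : ∀ ⦃j : SimplexCategory⦄ (ψ : j ⟶ ⦋d⦌), ¬ Epi ψ → Mem A (ψ ≫ σ) := by
    intro j ψ hψ
    obtain ⟨i, e, τ, he, hτ, rfl⟩ := exists_epi_mono_fac ψ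
    rw [Category.assoc]
    refine Mem.comp (hmin _ (mono_comp _ _) ?_ (hσB.comp τ)) e
    exact len_lt_of_mem_boundary (mem_boundary_iff_not_epi.2 fun (_ : Epi τ) => hψ (epi_comp _ _))
  obtain ⟨M', m', c', r', hc', hr', hm', hcr'⟩ := hc.attach_cell hQ σ (hf d σ hσ hσB hσA) hσA
    (hσB.mono hBS) hbd hAA' hσA' (by
      rintro j φ (hφ | ⟨ψ, hψ⟩)
      · exact Or.inl hφ
      · exact Or.inr ⟨ψ.unop, (SSet.stdSimplex.objEquiv.symm.injective hψ).symm⟩)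
  have hlt : (cells A').ncard < (cells A).ncard := by
    refine Set.ncard_lt_ncard ⟨fun x hx => ⟨hx.1, hx.2.1, fun h => hx.2.2 (h.mono hAA')⟩,
      fun hsub => ?_⟩ (Set.toFinite _)
    have hd : d < k + 1 := Nat.lt_succ_of_le (SimplexCategory.len_le_of_mono σ)
    exact (@hsub ⟨⟨d, hd⟩, σ⟩ ⟨hσ, hσB, hσA⟩).2.2 hσA'
  obtain ⟨N, n, c'', r, hc'', hr, hn, hcr⟩ := ih _ (h ▸ hlt) hc' hA'B
    (fun e τ hτ hB hA => hf e τ hτ hB fun h => hA (h.mono hAA')) rfl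
  refine ⟨N, n, c'', r ≫ r', hc'', Q.comp_mem _ _ hr hr', by rw [Category.assoc, hm', hn], ?_⟩
  rw [HomCone.precomp_comp, hcr']
  refine HomCone.ext' fun j φ h => ?_
  exact congrArg (fun t => t.at' φ (h.mono hAA')) hcr

end HigherStack

namespace HigherStack

variable {C : Type u} [Category.{v} C] {X Y T : SimplicialObject C} {f : X ⟶ Y} {k : ℕ}
  {A B S : (Δ[k] : SSet.{0}).Subcomplex} {U V M : C} {i j : SimplexCategory}
  {Q W : MorphismProperty C}

/-! ### Consequences for relative cones -/

lemma IsPullbackClass.of_isIso (hQ : IsPullbackClass Q) {M N : C} (g : M ⟶ N) [IsIso g] : Q g := by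
  have := hQ.isMultiplicative
  have := hQ.isStableUnderBaseChange
  have : Q.RespectsIso := inferInstance
  exact Q.of_isIso g

/-- A relative cone is a lift of the tautological simplex over `Y_k`, defined on all of `Δ^k`. -/
lemma RelCone.IsUniversal.representsLifts {c : RelCone f A M} (hc : c.IsUniversal) :
    RepresentsLifts f (HomCone.restriction Y ⊤) c.base c.lift where
  isLift _ φ hA _ := c.comm_at' φ hA
  exists_lift b t ht := by
    obtain ⟨g, hg, -⟩ := hc _ (RelCone.mk' t b fun j φ hφ => ht φ hφ trivial)
    exact ⟨g, congrArg RelCone.base hg, congrArg RelCone.lift hg⟩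
  hom_ext e₁ e₂ := hc.hom_ext (RelCone.ext e₂ e₁)

lemma RepresentsLifts.isUniversal {m : M ⟶ Y.obj (op ⦋k⦌)} {c : HomCone (A : SSet.{0}) X M}
    (h : RepresentsLifts f (HomCone.restriction Y ⊤) m c) :
    (RelCone.mk' (f := f) c m fun _ φ hφ => h.isLift φ hφ trivial).IsUniversal := by
  intro U t
  obtain ⟨g, hg, hg'⟩ := h.exists_lift t.base t.lift fun j φ hA _ => t.comm_at' φ hA
  exact ⟨g, RelCone.ext hg' hg, fun g' e =>
    h.hom_ext ((congrArg RelCone.base e).trans hg.symm) ((congrArg RelCone.lift e).trans hg'.symm)⟩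

-- Yoneda: a cone over all of `Δ^k` is determined by its value at the identity.
variable (f k) in
lemma isUniversal_restriction_top :
    (RelCone.restriction f (⊤ : (Δ[k] : SSet.{0}).Subcomplex)).IsUniversal := by
  intro U t
  refine ⟨t.lift.at' (𝟙 _) trivial, RelCone.ext' ?_ fun j φ hφ => ?_, fun g hg => ?_⟩
  · refine (t.comm_at' (𝟙 _) trivial).trans ?_
    simp
  · exact (t.lift.at'_comp _ _ φ).trans (t.lift.at'_congr (Category.comp_id φ) _ _)
  · have := congrArg (fun t => t.lift.at' (𝟙 _) trivial) hg
    change g ≫ X.map (𝟙 _) = _ at this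
    rwa [X.map_id, Category.comp_id] at this

/-- The start of every cell attachment: over the empty subset there is nothing to lift. -/
lemma representsLifts_bot (f : X ⟶ Y) (D : HomCone (S : SSet.{0}) Y V) :
    ∃ c : HomCone (((⊥ : (Δ[k] : SSet.{0}).Subcomplex)) : SSet.{0}) X V,
      RepresentsLifts f D (𝟙 V) c :=
  ⟨HomCone.ofFamily (fun φ h => (not_mem_bot φ h).elim) fun _ φ h => (not_mem_bot φ h).elim,
    { isLift := fun _ φ h => (not_mem_bot φ h).elim
      exists_lift := fun b _ _ => ⟨b, Category.comp_id b,
        HomCone.ext' fun _ φ h => (not_mem_bot φ h).elim⟩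
      hom_ext := fun e _ => by simpa using e }⟩

/-- Existence of `hom(A, X) ×_{hom(A, Y)} Y_k` when the matching maps of the cells of `A` are in
a class of morphisms along which pullbacks exist. -/
lemma exists_isUniversal (hQ : IsPullbackClass Q) (f : X ⟶ Y)
    (A : (Δ[k] : SSet.{0}).Subcomplex)
    (hf : ∀ (d : ℕ) (σ : ⦋d⦌ ⟶ ⦋k⦌), Mono σ → Mem A σ →
      RelRestrictionHas Q f (SSet.boundary d)) :
    ∃ (M : C) (c : RelCone f A M), c.IsUniversal := by
  obtain ⟨c, hc⟩ := representsLifts_bot f (HomCone.restriction Y (⊤ : (Δ[k] : SSet.{0}).Subcomplex))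
  obtain ⟨N, n, c', -, hc', -⟩ := hc.extend hQ (bot_le : ⊥ ≤ A) le_top
    fun d σ hσ h _ => hf d σ hσ h
  exact ⟨N, _, hc'.isUniversal⟩

/-- The map `X_k → hom(A, X) ×_{hom(A, Y)} Y_k` is in the class `Q` as soon as the matching maps
for the cells not in `A` are. -/
lemma RelCone.IsUniversal.exists_restriction (hQ : IsPullbackClass Q) {c : RelCone f A M}
    (hc : c.IsUniversal)
    (hf : ∀ (d : ℕ) (σ : ⦋d⦌ ⟶ ⦋k⦌), Mono σ → ¬ Mem A σ →
      RelRestrictionHas Q f (SSet.boundary d)) :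
    ∃ r : X.obj (op ⦋k⦌) ⟶ M, c.precomp r = RelCone.restriction f A ∧ Q r := by
  have := hQ.isMultiplicative
  obtain ⟨N, n, c', r, hc', hr, hn, hcr⟩ := hc.representsLifts.extend hQ (le_top : A ≤ ⊤) le_rfl
    fun d σ hσ _ h => hf d σ hσ h
  -- By Yoneda both `N` and `X_k` represent cones over all of `Δ^k`; `g` is the comparison.
  obtain ⟨g, hg, -⟩ := hc'.isUniversal _ (RelCone.restriction f ⊤)
  obtain ⟨g', hg', -⟩ := isUniversal_restriction_top f k _
    (RelCone.mk' (f := f) c' n fun _ φ hφ => hc'.isLift φ hφ trivial)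
  have : IsIso g := ⟨g', by
    apply (isUniversal_restriction_top f k).hom_ext
    rw [RelCone.precomp_comp, hg', hg, RelCone.precomp_id], by
    apply hc'.isUniversal.hom_ext
    rw [RelCone.precomp_comp, hg, hg', RelCone.precomp_id]⟩
  refine ⟨g ≫ r, RelCone.ext' ?_ fun j φ hφ => ?_, Q.comp_mem _ _ (hQ.of_isIso g) hr⟩
  · rw [RelCone.precomp_base, Category.assoc, hn]
    exact congrArg RelCone.base hg
  · rw [RelCone.precomp_lift, HomCone.precomp_comp, hcr]
    exact congrArg (fun t => t.lift.at' φ trivial) hg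

lemma relRestrictionHas (hQ : IsPullbackClass Q) {c : RelCone f A M} (hc : c.IsUniversal)
    (hf : ∀ (d : ℕ) (σ : ⦋d⦌ ⟶ ⦋k⦌), Mono σ → ¬ Mem A σ →
      RelRestrictionHas Q f (SSet.boundary d)) :
    RelRestrictionHas Q f A :=
  ⟨M, c, hc, hc.exists_restriction hQ hf⟩

lemma RelRestrictionHas.of_iso (hQ : IsPullbackClass Q)
    (h : (RelCone.restriction f A).IsUniversal) : RelRestrictionHas Q f A :=
  ⟨_, _, h, 𝟙 _, RelCone.precomp_id _, hQ.of_isIso _⟩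

/-- The cones over `A` extend uniquely to all of `Δ^k` if the matching maps of the cells not in
`A` are isomorphisms. -/
lemma isUniversal_restriction (hW : IsPullbackClass W)
    (hfW : ∀ (d : ℕ) (σ : ⦋d⦌ ⟶ ⦋k⦌), Mono σ → Mem A σ → RelRestrictionHas W f (SSet.boundary d))
    (hf : ∀ (d : ℕ) (σ : ⦋d⦌ ⟶ ⦋k⦌), Mono σ → ¬ Mem A σ →
      (RelCone.restriction f (SSet.boundary d)).IsUniversal) :
    (RelCone.restriction f A).IsUniversal := by
  obtain ⟨M, c, hc⟩ := exists_isUniversal hW f A hfW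
  exact relRestrictionHas_isomorphisms_iff.1 (relRestrictionHas (isPullbackClass_isomorphisms C) hc
    fun d σ hσ h => relRestrictionHas_isomorphisms_iff.2 (hf d σ hσ h))

/-- The total object of a map all of whose matching maps are covers is a Lie `∞`-groupoid if the
target is. -/
theorem IsLieGroupoid.of_cover (hW : IsPullbackClass W) (hY : IsLieGroupoid W ⊤ Y) (f : X ⟶ Y)
    (hf : ∀ k : ℕ, RelRestrictionHas W f (SSet.boundary k)) : IsLieGroupoid W ⊤ X where
  iso k i _ h := absurd h (by simp)
  cover k i hk := by
    obtain ⟨V, D, hD, s, hs, hsW⟩ := hY.cover k i hk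
    obtain ⟨c₀, hc₀⟩ := representsLifts_bot f D
    -- A horn in `X` is a horn in `Y`, classified by `V`, with a lift, so `N` will be `hom(Λ, X)`.
    -- The horn `D` is not assumed to extend to a simplex of `Y`; this is why lifts are taken
    -- relative to a cone over `S`.
    obtain ⟨N, n, c, -, hc, -⟩ := hc₀.extend hW bot_le le_rfl fun d _ _ _ _ => hf d
    have hcn : c.postcomp f = D.precomp n := HomCone.ext' fun j φ hφ => hc.isLift φ hφ hφ
    have := hW.hasPullback s n hsW
    have := hW.isStableUnderBaseChange
    have := hW.isMultiplicative
    have hs' : ∀ ⦃j : SimplexCategory⦄ (φ : j ⟶ ⦋k⦌) (hφ : Mem (SSet.horn k i) φ),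
        s ≫ D.at' φ hφ = Y.map φ.op := fun j φ hφ => congrArg (fun t => t.at' φ hφ) hs
    -- The object of relative horns is the base change of `Y_k → V` along `n`. So `X_k → N` is a
    -- cover onto the relative horns followed by a base change of the cover `s`.
    let c' : RelCone f (SSet.horn k i) (pullback s n) :=
      RelCone.mk' (c.precomp (pullback.snd s n)) (pullback.fst s n) fun j φ hφ => by
        rw [HomCone.precomp_at', Category.assoc, hc.isLift φ hφ hφ, ← hs' φ hφ,
          pullback.condition_assoc]
    have hc' : c'.IsUniversal := by
      intro U t
      obtain ⟨g, hg, hg'⟩ := hc.exists_lift (t.base ≫ s) t.lift fun j φ hφ hφ' => by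
        rw [t.comm_at', Category.assoc, hs' φ hφ']
      refine ⟨pullback.lift t.base g hg.symm, RelCone.ext ?_ (pullback.lift_fst _ _ _),
        fun g' e => ?_⟩
      · change (c.precomp _).precomp _ = _
        rw [← HomCone.precomp_comp, pullback.lift_snd, hg']
      · have e₁ : g' ≫ pullback.fst s n = t.base := congrArg RelCone.base e
        have e₂ : (c.precomp _).precomp g' = t.lift := congrArg RelCone.lift e
        apply pullback.hom_ext
        · rw [pullback.lift_fst, e₁]
        · rw [pullback.lift_snd]
          apply hc.hom_ext
          · rw [hg, Category.assoc, ← pullback.condition, reassoc_of% e₁]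
          · rw [HomCone.precomp_comp, e₂, hg']
    obtain ⟨r, hr, hrW⟩ := hc'.exists_restriction hW fun d _ _ _ => hf d
    refine ⟨N, c, ?_, r ≫ pullback.snd s n, ?_,
      W.comp_mem _ _ hrW (MorphismProperty.pullback_snd _ _ hsW)⟩
    · intro U t
      obtain ⟨b, hb, -⟩ := hD U (t.postcomp f)
      obtain ⟨g, hg, hg'⟩ := hc.exists_lift b t fun j φ hφ _ =>
        congrArg (fun t => t.at' φ hφ) hb.symm
      refine ⟨g, hg', fun g' e => hc.hom_ext ?_ (e.trans hg'.symm)⟩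
      apply (hD U (t.postcomp f)).unique
      · rw [HomCone.precomp_comp, ← hcn, ← HomCone.precomp_postcomp, e]
      · rw [hg, hb]
    · rw [HomCone.precomp_comp]
      exact congrArg RelCone.lift hr

end HigherStack

namespace HigherStack

variable {C : Type u} [Category.{v} C] {X Y T : SimplicialObject C} {f : X ⟶ Y} {q : X ⟶ T}
  {p : T ⟶ Y} {k n : ℕ} {A B S : (Δ[k] : SSet.{0}).Subcomplex} {U V M : C}
  {i j : SimplexCategory} {Q W : MorphismProperty C}

/-! ### Maps which are isomorphisms below a given degree and coskeletal above it -/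

lemma RelCone.IsUniversal.eq_of_restriction (h : (restriction p A).IsUniversal)
    {x y : U ⟶ T.obj (op ⦋k⦌)} (hb : x ≫ p.app (op ⦋k⦌) = y ≫ p.app (op ⦋k⦌))
    (hl : ∀ (j : SimplexCategory) (φ : j ⟶ ⦋k⦌), Mono φ → Mem A φ →
      x ≫ T.map φ.op = y ≫ T.map φ.op) : x = y :=
  h.hom_ext (RelCone.ext (HomCone.ext_of_mono fun j φ hA hφ => hl j φ hφ hA) hb)

lemma isUniversal_restriction_of_isIso
    (h : ∀ d : ℕ, d ≤ k → IsIso (q.app (op ⦋d⦌))) : (RelCone.restriction q A).IsUniversal := by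
  intro U t
  have := h k le_rfl
  refine ⟨t.base ≫ inv (q.app (op ⦋k⦌)), RelCone.ext (HomCone.ext_of_mono fun j φ hA hφ => ?_) ?_,
    fun g hg => ?_⟩
  · have : IsIso (q.app (op j)) := h j.len (SimplexCategory.len_le_of_mono φ)
    rw [← cancel_mono (q.app (op j)), t.comm_at']
    change ((t.base ≫ inv (q.app (op ⦋k⦌))) ≫ X.map φ.op) ≫ q.app (op j) = _
    simp
  · simp
  · rw [IsIso.eq_comp_inv, ← hg]
    rfl

lemma HomCone.postcomp_injective (hA : A ≤ (Δ[k] : SSet.{0}).skeleton n)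
    (hq : ∀ d : ℕ, d < n → IsIso (q.app (op ⦋d⦌))) {c c' : HomCone (A : SSet.{0}) X U}
    (h : c.postcomp q = c'.postcomp q) : c = c' := by
  refine ext_of_mono fun j φ hφA hφ => ?_
  have : IsIso (q.app (op j)) := hq j.len (len_lt_of_mem_skeleton (hφA.mono hA))
  rw [← cancel_mono (q.app (op j))]
  exact congrArg (fun t => t.at' φ hφA) h

/-- Inverting `q` simplexwise fails on degenerate simplices of dimension `≥ n`. Attaching cells uses
only the nondegenerate ones, where `q` is invertible. -/
lemma HomCone.exists_postcomp_eq (hA : A ≤ (Δ[k] : SSet.{0}).skeleton n)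
    (hq : ∀ d : ℕ, d < n → IsIso (q.app (op ⦋d⦌))) (t : HomCone (A : SSet.{0}) T U) :
    ∃ c : HomCone (A : SSet.{0}) X U, c.postcomp q = t := by
  obtain ⟨c₀, hc₀⟩ := representsLifts_bot q t
  obtain ⟨N, m, c, r, hc, hr, hrm, -⟩ := hc₀.extend (isPullbackClass_isomorphisms C) bot_le le_rfl
    fun d σ hσ h _ => relRestrictionHas_isomorphisms_iff.2 (isUniversal_restriction_of_isIso
      fun d' hd' => hq d' (hd'.trans_lt (len_lt_of_mem_skeleton (h.mono hA))))
  have : IsIso r := hr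
  rw [Category.comp_id] at hrm
  subst hrm
  refine ⟨c.precomp (inv r), HomCone.ext' fun j φ hφ => ?_⟩
  rw [postcomp_at', precomp_at', Category.assoc, hc.isLift φ hφ hφ, IsIso.inv_hom_id_assoc]

/-- The image of a relative cone for a composition under the first map. -/
def RelCone.postcomp (c : RelCone f A U) (e : q ≫ p = f) : RelCone p A U :=
  RelCone.mk' (c.lift.postcomp q) c.base fun j φ hφ => by
    rw [← c.comm_at' φ hφ, HomCone.postcomp_at', Category.assoc]
    exact congrArg (fun g => c.lift.at' φ hφ ≫ g.app (op j)) e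

lemma RelCone.exists_postcomp_eq (hA : A ≤ (Δ[k] : SSet.{0}).skeleton n)
    (hq : ∀ d : ℕ, d < n → IsIso (q.app (op ⦋d⦌))) (e : q ≫ p = f) (t : RelCone p A U) :
    ∃ c : RelCone f A U, c.postcomp e = t := by
  obtain ⟨l, hl⟩ := HomCone.exists_postcomp_eq hA hq t.lift
  refine ⟨RelCone.mk' l t.base fun j φ hφ => ?_, RelCone.ext hl rfl⟩
  rw [← t.comm_at' φ hφ, ← hl, HomCone.postcomp_at', Category.assoc, ← e]
  rfl

/-- Composition with `q` is a bijection on cones over `A`, so limits for `f` and for `p` are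
interchangeable there. -/
lemma RelCone.isUniversal_postcomp_iff (hA : A ≤ (Δ[k] : SSet.{0}).skeleton n)
    (hq : ∀ d : ℕ, d < n → IsIso (q.app (op ⦋d⦌))) (e : q ≫ p = f) (c : RelCone f A M) :
    (c.postcomp e).IsUniversal ↔ c.IsUniversal := by
  have key : ∀ {U : C} (t : RelCone f A U) (g : U ⟶ M),
      (c.postcomp e).precomp g = t.postcomp e ↔ c.precomp g = t := by
    intro U t g
    refine ⟨fun h => RelCone.ext (HomCone.postcomp_injective hA hq ?_)
      (congrArg RelCone.base h :), fun h => h ▸ RelCone.ext ?_ rfl⟩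
    · rw [RelCone.precomp_lift, HomCone.precomp_postcomp]
      exact congrArg RelCone.lift h
    · exact (HomCone.precomp_postcomp _ _ _).symm
  constructor
  · intro h U t
    simpa only [key] using h U (t.postcomp e)
  · intro h U t
    obtain ⟨t, rfl⟩ := RelCone.exists_postcomp_eq hA hq e t
    simpa only [key] using h U t

/-- A factorization `f = q ≫ p` in which `q` is an isomorphism in degrees `< n` and the matching
maps of `p` are isomorphisms in degrees `≥ n`. -/
structure IsRelTruncation (n : ℕ) (f : X ⟶ Y) (q : X ⟶ T) (p : T ⟶ Y) : Prop where
  fac : q ≫ p = f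
  isIso : ∀ k : ℕ, k < n → IsIso (q.app (op ⦋k⦌))
  matching : ∀ k : ℕ, n ≤ k → (RelCone.restriction p (SSet.boundary k)).IsUniversal

/-! ### Consequences of the factorization: matching maps, hypercovers, coskeleta. -/

namespace IsRelTruncation

/-- Below degree `n` the matching map of `p` is that of `f` up to the isomorphism `q`; from `n` on
it is invertible. -/
lemma relRestrictionHas (h : IsRelTruncation n f q p) (hW : IsPullbackClass W)
    (hf : ∀ k : ℕ, RelRestrictionHas W f (SSet.boundary k)) (k : ℕ) :
    RelRestrictionHas W p (SSet.boundary k) := by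
  have := hW.isMultiplicative
  by_cases hk : k < n
  · obtain ⟨M, c, hc, r, hr, hrW⟩ := hf k
    have := h.isIso k hk
    refine ⟨M, c.postcomp h.fac,
      (RelCone.isUniversal_postcomp_iff (boundary_le_skeleton hk.le) h.isIso h.fac c).2 hc,
      inv (q.app (op ⦋k⦌)) ≫ r, ?_, W.comp_mem _ _ (hW.of_isIso _) hrW⟩
    have hb : r ≫ c.base = f.app (op ⦋k⦌) := congrArg RelCone.base hr
    refine RelCone.ext' ?_ fun j φ hφ => ?_
    · change (inv (q.app (op ⦋k⦌)) ≫ r) ≫ c.base = _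
      rw [Category.assoc, hb, IsIso.inv_comp_eq, ← h.fac]
      rfl
    · have hl : r ≫ c.lift.at' φ hφ = X.map φ.op := congrArg (fun t => t.lift.at' φ hφ) hr
      change (inv (q.app (op ⦋k⦌)) ≫ r) ≫ c.lift.at' φ hφ ≫ q.app (op j) = T.map φ.op
      rw [Category.assoc, reassoc_of% hl, IsIso.inv_comp_eq, q.naturality]
  · exact RelRestrictionHas.of_iso hW (h.matching k (not_lt.1 hk))

lemma isUniversal_restriction (h : IsRelTruncation n f q p) (hW : IsPullbackClass W)
    (hf : ∀ k : ℕ, RelRestrictionHas W f (SSet.boundary k))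
    (hA : ∀ (d : ℕ) (σ : ⦋d⦌ ⟶ ⦋k⦌), Mono σ → ¬ Mem A σ → n ≤ d) :
    (RelCone.restriction p A).IsUniversal :=
  HigherStack.isUniversal_restriction hW (fun d _ _ _ => h.relRestrictionHas hW hf d)
    fun d σ hσ hσA => h.matching d (hA d σ hσ hσA)

lemma isHypercover_right (h : IsRelTruncation n f q p) (hW : IsPullbackClass W)
    (hf : IsHypercover W ⊤ f) : IsHypercover W n p where
  source := hf.target.of_cover hW p (h.relRestrictionHas hW hf.cover)
  target := hf.target
  cover := h.relRestrictionHas hW hf.cover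
  iso k hk := relRestrictionHas_isomorphisms_iff.2 (h.matching k (by simpa using hk))

lemma isHypercover_left (h : IsRelTruncation n f q p) (hW : IsPullbackClass W)
    (hf : IsHypercover W ⊤ f) : IsHypercover W ⊤ q where
  source := hf.source
  target := (h.isHypercover_right hW hf).source
  iso k hk := absurd hk (by simp)
  cover k := by
    by_cases hk : k < n
    · exact RelRestrictionHas.of_iso hW
        (isUniversal_restriction_of_isIso fun d hd => h.isIso d (hd.trans_lt hk))
    obtain ⟨M, c, hc, r, hr, hrW⟩ := hf.cover k
    have hp := h.matching k (not_lt.1 hk)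
    -- Since `T_k = M_k(p)`, the component in `T_k` of a relative boundary for `q` is forced. Hence
    -- `M_k(q) = M_k(f)`, with the same map `r` from `X_k`.
    obtain ⟨t, ht, -⟩ := hp M (c.postcomp h.fac)
    have hfac : ∀ j : SimplexCategory, q.app (op j) ≫ p.app (op j) = f.app (op j) := fun j => by
      rw [← h.fac]; rfl
    have htb : t ≫ p.app (op ⦋k⦌) = c.base := congrArg RelCone.base ht
    have htl : ∀ ⦃j : SimplexCategory⦄ (φ : j ⟶ ⦋k⦌) (hφ : Mem (SSet.boundary k) φ),
        t ≫ T.map φ.op = c.lift.at' φ hφ ≫ q.app (op j) := fun j φ hφ =>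
      congrArg (fun t => t.lift.at' φ hφ) ht
    refine ⟨M, RelCone.mk' c.lift t fun j φ hφ => (htl φ hφ).symm, fun U s => ?_, r, ?_, hrW⟩
    · obtain ⟨g, hg, -⟩ := hc U (RelCone.mk' s.lift (s.base ≫ p.app (op ⦋k⦌)) fun j φ hφ => by
        rw [← hfac, ← Category.assoc, s.comm_at', Category.assoc, Category.assoc, p.naturality])
      have hgl : c.lift.precomp g = s.lift := congrArg RelCone.lift hg
      have hgb : g ≫ c.base = s.base ≫ p.app (op ⦋k⦌) := congrArg RelCone.base hg
      refine ⟨g, RelCone.ext hgl ?_, fun g' hg' => hc.hom_ext (RelCone.ext ?_ ?_)⟩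
      · apply hp.eq_of_restriction
        · change (g ≫ t) ≫ _ = _
          rw [Category.assoc, htb, hgb]
        · intro j φ _ hφ
          change (g ≫ t) ≫ _ = _
          rw [Category.assoc, htl φ hφ, ← s.comm_at' φ hφ, ← hgl]
          simp
      · exact (congrArg RelCone.lift hg').trans hgl.symm
      · have : g' ≫ t = s.base := congrArg RelCone.base hg'
        change g' ≫ c.base = g ≫ c.base
        rw [hgb, ← this, Category.assoc, htb]
    · refine RelCone.ext (congrArg RelCone.lift hr :) ?_
      apply hp.eq_of_restriction
      · change (r ≫ t) ≫ _ = _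
        rw [Category.assoc, htb]
        exact (congrArg RelCone.base hr).trans (hfac _).symm
      · intro j φ _ hφ
        change (r ≫ t) ≫ _ = q.app _ ≫ _
        have hl : r ≫ c.lift.at' φ hφ = X.map φ.op := congrArg (fun t => t.lift.at' φ hφ) hr
        rw [Category.assoc, htl φ hφ, reassoc_of% hl, q.naturality]

/-- The middle object of such a factorization is the relative coskeleton. -/
theorem isRelCoskeleton (h : IsRelTruncation n f q p) (hW : IsPullbackClass W)
    (hf : ∀ k : ℕ, RelRestrictionHas W f (SSet.boundary k)) : IsRelCoskeleton n f q p := by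
  have hex := fun k : ℕ => RelCone.exists_postcomp_eq (le_refl ((Δ[k] : SSet.{0}).skeleton n))
    h.isIso h.fac (RelCone.restriction p _)
  choose c hc using hex
  have hcb : ∀ k : ℕ, (c k).base = p.app (op ⦋k⦌) := fun k => congrArg RelCone.base (hc k)
  have hcl : ∀ (k : ℕ) ⦃j : SimplexCategory⦄ (φ : j ⟶ ⦋k⦌)
      (hφ : Mem ((Δ[k] : SSet.{0}).skeleton n) φ),
      (c k).lift.at' φ hφ ≫ q.app (op j) = T.map φ.op := fun k j φ hφ =>
    congrArg (fun t => t.lift.at' φ hφ) (hc k)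
  refine ⟨c, fun k => ?_, fun k l α => RelCone.ext ?_ ?_, hcb, fun k => RelCone.ext ?_ ?_⟩
  · rw [← RelCone.isUniversal_postcomp_iff le_rfl h.isIso h.fac, hc]
    refine h.isUniversal_restriction hW hf fun d σ hσ hσA => ?_
    by_contra hd
    exact hσA (mem_skeleton_of_lt σ (not_le.1 hd))
  · refine HomCone.postcomp_injective le_rfl h.isIso (HomCone.ext' fun j φ hφ => ?_)
    rw [HomCone.postcomp_at', HomCone.postcomp_at', RelCone.precomp_lift, HomCone.precomp_at',
      Category.assoc, hcl, RelCone.pull_lift_at', hcl, op_comp, T.map_comp]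
  · rw [RelCone.precomp_base, hcb, RelCone.pull_base, hcb, p.naturality]
  · refine HomCone.postcomp_injective le_rfl h.isIso (HomCone.ext' fun j φ hφ => ?_)
    rw [HomCone.postcomp_at', HomCone.postcomp_at', RelCone.precomp_lift, HomCone.precomp_at',
      Category.assoc, hcl, ← q.naturality]
    rfl
  · rw [RelCone.precomp_base, hcb, ← h.fac]
    rfl

end IsRelTruncation

/-- The relative coskeleton is the middle object of such a factorization. -/
theorem IsRelCoskeleton.isRelTruncation (h : IsRelCoskeleton n f q p) :
    IsRelTruncation n f q p := by
  obtain ⟨c, hc, hpull, hbase, hq⟩ := h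
  have hfac : ∀ k : ℕ, q.app (op ⦋k⦌) ≫ p.app (op ⦋k⦌) = f.app (op ⦋k⦌) := fun k => by
    rw [← hbase]
    exact congrArg RelCone.base (hq k)
  have hfac' : q ≫ p = f := by
    ext j
    exact hfac j.unop.len
  have hql : ∀ (k : ℕ) ⦃j : SimplexCategory⦄ (φ : j ⟶ ⦋k⦌)
      (hφ : Mem ((Δ[k] : SSet.{0}).skeleton n) φ),
      q.app (op ⦋k⦌) ≫ (c k).lift.at' φ hφ = X.map φ.op := fun k j φ hφ =>
    congrArg (fun t => t.lift.at' φ hφ) (hq k)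
  have hiso : ∀ k : ℕ, k < n → IsIso (q.app (op ⦋k⦌)) := by
    intro k hk
    -- For `k < n` the skeleton is all of `Δ^k`, so `X_k` and `T_k` represent the same cones.
    have htop := isUniversal_restriction_top f k
    rw [← skeleton_eq_top hk, ← hq k] at htop
    obtain ⟨g, hg, -⟩ := htop _ (c k)
    rw [← RelCone.precomp_comp] at hg
    have hgq : g ≫ q.app (op ⦋k⦌) = 𝟙 _ := (hc k).hom_ext (hg.trans (RelCone.precomp_id _).symm)
    refine ⟨g, htop.hom_ext ?_, hgq⟩
    rw [RelCone.precomp_id, ← RelCone.precomp_comp, Category.assoc, hgq, Category.comp_id]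
  -- The universal cone, pushed into `T`, is the tautological one; both sides are compared through
  -- the universal property of `T_j`.
  have hlq : ∀ (k : ℕ) ⦃j : SimplexCategory⦄ (φ : j ⟶ ⦋k⦌)
      (hφ : Mem ((Δ[k] : SSet.{0}).skeleton n) φ),
      (c k).lift.at' φ hφ ≫ q.app (op j) = T.map φ.op := by
    intro k j φ hφ
    induction j using SimplexCategory.rec with | _ j =>
    apply (hc j).hom_ext
    refine RelCone.ext' ?_ fun i ψ hψ => ?_
    · rw [RelCone.precomp_base, RelCone.precomp_base, hbase, Category.assoc, hfac,
        (c k).comm_at' φ hφ, hbase, p.naturality]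
    · refine Eq.trans ?_ (congrArg (fun t => t.lift.at' ψ hψ) (hpull k j φ)).symm
      change ((c k).lift.at' φ hφ ≫ q.app _) ≫ (c j).lift.at' ψ hψ = (c k).lift.at' (ψ ≫ φ) _
      rw [Category.assoc, hql, (c k).lift.at'_comp]
  refine ⟨hfac', hiso, fun k hk U t => ?_⟩
  have hext : ∀ (d : ℕ) {x y : U ⟶ T.obj (op ⦋d⦌)},
      x ≫ p.app (op ⦋d⦌) = y ≫ p.app (op ⦋d⦌) →
      (∀ (j : SimplexCategory) (φ : j ⟶ ⦋d⦌), Mono φ →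
        Mem ((Δ[d] : SSet.{0}).skeleton n) φ → x ≫ T.map φ.op = y ≫ T.map φ.op) → x = y := by
    intro d x y hb hl
    refine (hc d).hom_ext (RelCone.ext (HomCone.ext_of_mono fun j φ hφ hm => ?_) ?_)
    · have : IsIso (q.app (op j)) := hiso j.len (len_lt_of_mem_skeleton hφ)
      rw [← cancel_mono (q.app (op j)), RelCone.precomp_lift, RelCone.precomp_lift,
        HomCone.precomp_at', HomCone.precomp_at', Category.assoc, Category.assoc, hlq]
      exact hl j φ hm hφ
    · rwa [RelCone.precomp_base, RelCone.precomp_base, hbase]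
  -- Only the skeleton of `t` is needed to produce `x`; by `hext` the faces of `t` outside it are
  -- determined by their own skeleta and images in `Y`.
  obtain ⟨s, hs⟩ := RelCone.exists_postcomp_eq le_rfl hiso hfac'
    (t.restrict (skeleton_le_boundary hk))
  obtain ⟨x, hx, -⟩ := hc k U s
  have hxb : x ≫ p.app (op ⦋k⦌) = t.base := by
    rw [← hbase]
    exact (congrArg RelCone.base hx).trans (congrArg RelCone.base hs)
  have hxl : ∀ ⦃j : SimplexCategory⦄ (φ : j ⟶ ⦋k⦌) (hφ : Mem ((Δ[k] : SSet.{0}).skeleton n) φ),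
      x ≫ T.map φ.op = t.lift.at' φ (hφ.mono (skeleton_le_boundary hk)) := by
    intro j φ hφ
    rw [← hlq k φ hφ]
    refine Eq.trans ?_ (congrArg (fun t => t.lift.at' φ hφ) hs)
    rw [← Category.assoc]
    exact congrArg (fun t => t.lift.at' φ hφ ≫ q.app (op j)) hx
  refine ⟨x, RelCone.ext' hxb fun j φ hφ => ?_, fun y hy => hext k ?_ fun j φ _ hφ => ?_⟩
  · induction j using SimplexCategory.rec with | _ j =>
    apply hext j
    · change (x ≫ T.map φ.op) ≫ _ = _
      rw [t.comm_at' φ hφ, ← hxb, Category.assoc, Category.assoc, p.naturality]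
    · intro i ψ _ hψ
      change (x ≫ T.map φ.op) ≫ _ = _
      have hψφ : Mem ((Δ[k] : SSet.{0}).skeleton n) (ψ ≫ φ) := hψ.mono (skeleton_le n φ)
      rw [t.lift.at'_comp, Category.assoc, ← T.map_comp, ← op_comp]
      exact hxl _ hψφ
  · rw [hxb]
    exact congrArg RelCone.base hy
  · rw [hxl φ hφ]
    exact congrArg (fun t => t.lift.at' φ (hφ.mono (skeleton_le_boundary hk))) hy

/-- A simplicial object over `Y` is coskeletal relative to `Y` from degree `n` on if its matching
map in degree `n` is an isomorphism, its simplices in degree `n + 1` are the relative horns, and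
it is relatively `(n + 1)`-coskeletal. -/
lemma isUniversal_restriction_boundary
    (h₀ : (RelCone.restriction p (SSet.boundary n)).IsUniversal) (i₀ : Fin (n + 2))
    (h₁ : (RelCone.restriction p (SSet.horn (n + 1) i₀)).IsUniversal)
    (h₂ : ∀ k : ℕ, (RelCone.restriction p ((Δ[k] : SSet.{0}).skeleton (n + 2))).IsUniversal)
    (k : ℕ) (hk : n ≤ k) : (RelCone.restriction p (SSet.boundary k)).IsUniversal := by
  obtain rfl | hk := hk.eq_or_lt
  · exact h₀
  -- Both remaining ranges have one pattern: simplices are uniquely determined by their data on some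
  -- `A ≤ ∂Δ^k`, and each missing face by its part in `A`. Here `A` is the horn if `k = n + 1`, the
  -- skeleton if `k > n + 1`.
  obtain ⟨A, hA, hAu, hext⟩ : ∃ A : (Δ[k] : SSet.{0}).Subcomplex, A ≤ SSet.boundary k ∧
      (RelCone.restriction p A).IsUniversal ∧
      ∀ (d : ℕ) (φ : ⦋d⦌ ⟶ ⦋k⦌), Mono φ → Mem (SSet.boundary k) φ → ¬ Mem A φ →
        ∃ B : (Δ[d] : SSet.{0}).Subcomplex, (RelCone.restriction p B).IsUniversal ∧
          B ≤ A.preimage (SSet.stdSimplex.map φ) := by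
    obtain rfl | hk := (Nat.succ_le_of_lt hk).eq_or_lt
    · refine ⟨_, horn_le_boundary i₀, h₁, fun d φ hφ hb hh => ?_⟩
      have hd : d < n + 1 := len_lt_of_mem_boundary hb
      -- The only missing face has dimension `n` and its boundary lies in the horn, so `h₀`
      -- determines it.
      obtain rfl : d = n := by
        by_contra hne
        exact hh (mem_horn_of_lt i₀ φ (show d < n by omega))
      exact ⟨_, h₀, le_of_mono_mem fun i ψ _ hψ =>
        mem_horn_of_lt i₀ (ψ ≫ φ) (len_lt_of_mem_boundary hψ)⟩
    · refine ⟨_, skeleton_le_boundary (Nat.succ_le_of_lt hk), h₂ k, fun d φ hφ _ hh => ?_⟩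
      exact ⟨_, h₂ d, skeleton_le _ _⟩
  intro U t
  obtain ⟨x, hx, hx'⟩ := hAu U (t.restrict hA)
  have hxb : x ≫ p.app (op ⦋k⦌) = t.base := congrArg RelCone.base hx
  have hxl : ∀ ⦃j : SimplexCategory⦄ (φ : j ⟶ ⦋k⦌) (hφ : Mem A φ),
      x ≫ T.map φ.op = t.lift.at' φ (hφ.mono hA) := fun j φ hφ =>
    congrArg (fun t => t.lift.at' φ hφ) hx
  refine ⟨x, RelCone.ext (HomCone.ext_of_mono fun j φ hφ hm => ?_) hxb, fun y hy => hx' y ?_⟩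
  · by_cases hφA : Mem A φ
    · exact hxl φ hφA
    induction j using SimplexCategory.rec with | _ j =>
    obtain ⟨B, hB, hBA⟩ := hext j φ hm hφ hφA
    apply hB.eq_of_restriction
    · change (x ≫ T.map φ.op) ≫ _ = _
      rw [RelCone.comm_at', ← hxb, Category.assoc, Category.assoc, p.naturality]
    · intro i ψ _ hψ
      change (x ≫ T.map φ.op) ≫ _ = _
      rw [HomCone.at'_comp, Category.assoc, ← T.map_comp, ← op_comp]
      exact hxl _ (hψ.mono hBA)
  · exact RelCone.ext (HomCone.ext' fun j φ hφ => congrArg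
      (fun t => t.lift.at' φ (hφ.mono hA)) hy) (congrArg RelCone.base hy :)

end HigherStack

namespace HigherStack

variable {C : Type u} [Category.{v} C] {X Y T : SimplicialObject C} {f : X ⟶ Y} {q : X ⟶ T}
  {p : T ⟶ Y} {k n : ℕ} {A B S : (Δ[k] : SSet.{0}).Subcomplex} {U V M : C}
  {i j : SimplexCategory} {Q W : MorphismProperty C}

/-! ### Existence of relative coskeleta -/

lemma RelCone.pull_precomp (c : RelCone f A U) {l : ℕ} (α : ⦋l⦌ ⟶ ⦋k⦌)
    {B : (Δ[l] : SSet.{0}).Subcomplex} (h : B ≤ A.preimage (SSet.stdSimplex.map α)) (g : V ⟶ U) :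
    (c.precomp g).pull α h = (c.pull α h).precomp g :=
  RelCone.ext' (Category.assoc _ _ _) fun _ _ _ => rfl

/-- Cell attachment supplies the limit in each degree; uniqueness in the universal properties
supplies functoriality and naturality. -/
theorem exists_isRelCoskeleton (hW : IsPullbackClass W) (f : X ⟶ Y)
    (hf : ∀ k : ℕ, RelRestrictionHas W f (SSet.boundary k)) (n : ℕ) :
    ∃ (T : SimplicialObject C) (q : X ⟶ T) (p : T ⟶ Y), IsRelCoskeleton n f q p := by
  choose M c hc using fun k : ℕ =>
    exists_isUniversal hW f ((Δ[k] : SSet.{0}).skeleton n) fun d _ _ _ => hf d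
  choose t ht using fun (k l : ℕ) (α : (⦋l⦌ : SimplexCategory) ⟶ ⦋k⦌) =>
    (hc l (M k) ((c k).pull α (skeleton_le n α))).exists
  choose q hq using fun k : ℕ => (hc k _ (RelCone.restriction f _)).exists
  let T : SimplicialObject C :=
    { obj := fun x => M x.unop.len
      map := fun {x y} α => t x.unop.len y.unop.len α.unop
      map_id := fun x => (hc x.unop.len).hom_ext (by
        rw [ht, RelCone.precomp_id]
        refine RelCone.ext' ?_ fun j φ hφ => ?_
        · exact (congrArg _ (Y.map_id _)).trans (Category.comp_id _)
        · exact (c _).lift.at'_congr (Category.comp_id φ) _ _)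
      map_comp := fun {x y z} α β => (hc z.unop.len).hom_ext (by
        rw [ht, RelCone.precomp_comp, ht, ← RelCone.pull_precomp, ht]
        refine RelCone.ext' ?_ fun j φ hφ => ?_
        · exact (congrArg _ (Y.map_comp _ _)).trans (Category.assoc _ _ _).symm
        · exact (c _).lift.at'_congr (Category.assoc _ _ _).symm _ _) }
  let q' : X ⟶ T :=
    { app := fun x => q x.unop.len
      naturality := fun x y α => (hc y.unop.len).hom_ext (by
        change (c _).precomp (X.map α ≫ q _) = (c _).precomp (q _ ≫ t _ _ _)
        rw [RelCone.precomp_comp, hq, RelCone.precomp_comp, ht, ← RelCone.pull_precomp, hq]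
        refine RelCone.ext' (f.naturality α) fun j φ hφ => ?_
        exact (X.map_comp _ _).symm) }
  let p' : T ⟶ Y :=
    { app := fun x => (c x.unop.len).base
      naturality := fun x y α => congrArg RelCone.base (ht x.unop.len y.unop.len α.unop) }
  exact ⟨T, q', p', c, hc, fun k l α => ht k l α, fun k => rfl, fun k => hq k⟩

/-! ### Higher morphism spaces -/

/-- A family of subobjects closed under the simplicial operators forms a simplicial object. -/
lemma exists_simplicialObject_of_subobjects (Z : SimplicialObject C)
    (R : ∀ (l : ℕ) ⦃U : C⦄, (U ⟶ Z.obj (op ⦋l⦌)) → Prop)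
    (hR : ∀ (k l : ℕ) (α : (⦋l⦌ : SimplexCategory) ⟶ ⦋k⦌) ⦃U : C⦄ (x : U ⟶ Z.obj (op ⦋k⦌)),
      R k x → R l (x ≫ Z.map α.op))
    (hex : ∀ l : ℕ, ∃ (P : C) (ι : P ⟶ Z.obj (op ⦋l⦌)), R l ι ∧
      ∀ ⦃U : C⦄ (x : U ⟶ Z.obj (op ⦋l⦌)), R l x → ∃! g : U ⟶ P, g ≫ ι = x) :
    ∃ (P : SimplicialObject C) (ι : P ⟶ Z), ∀ l : ℕ, R l (ι.app (op ⦋l⦌)) ∧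
      ∀ ⦃U : C⦄ (x : U ⟶ Z.obj (op ⦋l⦌)), R l x →
        ∃! g : U ⟶ P.obj (op ⦋l⦌), g ≫ ι.app (op ⦋l⦌) = x := by
  choose P ι hι hι' using hex
  have := hι
  choose t ht ht' using fun (k l : ℕ) (α : (⦋l⦌ : SimplexCategory) ⟶ ⦋k⦌) =>
    hι' l _ (hR k l α _ (hι k))
  refine ⟨{ obj := fun x => P x.unop.len
            map := fun {x y} α => t x.unop.len y.unop.len α.unop
            map_id := fun x => (ht' _ _ _ _ ?_).symm
            map_comp := fun {x y z} α β => (ht' _ _ _ _ ?_).symm },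
    { app := fun x => ι x.unop.len
      naturality := fun x y α => ht x.unop.len y.unop.len α.unop },
    fun l => ⟨hι l, hι' l⟩⟩
  · exact (Category.id_comp _).trans ((Category.comp_id _).symm.trans
      (congrArg _ (Z.map_id _).symm))
  · have e₁ := ht x.unop.len y.unop.len α.unop
    have e₂ := ht y.unop.len z.unop.len β.unop
    dsimp only at e₁ e₂ ⊢
    rw [Category.assoc, e₂, reassoc_of% e₁]
    exact congrArg _ (Z.map_comp _ _).symm

/-- The inclusion of the first factor and the first vertex of the second factor in
`Δ^{n-1} ⋆ Δ^l`. -/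
def joinVertex (n l : ℕ) : (⦋n⦌ : SimplexCategory) ⟶ ⦋n + l⦌ :=
  SimplexCategory.mkHom
    { toFun := fun i => ⟨i.val, by omega⟩
      monotone' := fun _ _ h => h }

lemma joinVertex_collapse (n l : ℕ) : joinVertex n l ≫ collapse n l = 𝟙 _ := by
  ext i : 3
  apply Fin.ext
  change min i.val n = i.val
  have := i.isLt
  simp only [SimplexCategory.len_mk] at this
  omega

lemma mem_boundaryJoin_joinVertex {l : ℕ} {φ : j ⟶ ⦋n⦌} (h : Mem (SSet.horn n (Fin.last n)) φ) :
    Mem (boundaryJoin n l) (φ ≫ joinVertex n l) := by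
  obtain ⟨i, hi, hφ⟩ := mem_horn.1 h
  refine mem_boundaryJoin.2 ⟨⟨i.val, by omega⟩, ?_, fun a e => hφ a ?_⟩
  · have : i.val ≠ n := fun e => hi (Fin.ext e)
    have := i.isLt
    dsimp only
    omega
  · exact Fin.ext (congrArg Fin.val e :)

/-- `joinVertex` is a section of `collapse` carrying the horn into the join, so the constant family
remembers its horn. -/
lemma pull_collapse_injective {l : ℕ} {h h' : RelCone f (SSet.horn n (Fin.last n)) U}
    (e : h.pull (collapse n l) (boundaryJoin_le n l) =
      h'.pull (collapse n l) (boundaryJoin_le n l)) : h = h' := by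
  refine RelCone.ext' ?_ fun j φ hφ => ?_
  · have e' := congrArg (fun t => t.base ≫ Y.map (joinVertex n l).op) e
    dsimp only [RelCone.pull_base] at e'
    rwa [Category.assoc, Category.assoc, ← Y.map_comp, ← op_comp, joinVertex_collapse, op_id,
      Y.map_id, Category.comp_id, Category.comp_id] at e'
  · have e' := congrArg (fun t => t.lift.at' _ (mem_boundaryJoin_joinVertex hφ)) e
    have eφ : (φ ≫ joinVertex n l) ≫ collapse n l = φ := by
      rw [Category.assoc, joinVertex_collapse, Category.comp_id]
    dsimp only [RelCone.pull_lift_at'] at e'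
    rwa [h.lift.at'_congr eφ _ hφ, h'.lift.at'_congr eφ _ hφ] at e'

lemma ordinalSum_map_val_of_lt (n : ℕ) {l m : SimplexCategory} (α : l ⟶ m)
    (a : Fin (n + l.len + 1)) (h : a.val < n) :
    (((ordinalSum n).map α).toOrderHom a).val = a.val :=
  ordinalSumMap_of_lt n α.toOrderHom a h

lemma ordinalSum_map_val_of_not_lt (n : ℕ) {l m : SimplexCategory} (α : l ⟶ m)
    (a : Fin (n + l.len + 1)) (h : ¬ a.val < n) :
    (((ordinalSum n).map α).toOrderHom a).val = n + (α.toOrderHom ⟨a.val - n, by omega⟩).val :=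
  ordinalSumMap_of_not_lt n α.toOrderHom a h

lemma ordinalSum_map_collapse (n : ℕ) {k l : ℕ} (α : (⦋l⦌ : SimplexCategory) ⟶ ⦋k⦌) :
    (ordinalSum n).map α ≫ collapse n k = collapse n l := by
  ext a : 3
  apply Fin.ext
  change min (((ordinalSum n).map α).toOrderHom a).val n = min a.val n
  by_cases h : a.val < n
  · rw [ordinalSum_map_val_of_lt n α a h]
  · rw [ordinalSum_map_val_of_not_lt n α a h]
    omega

lemma mem_boundaryJoin_ordinalSum {k l : ℕ} (α : (⦋l⦌ : SimplexCategory) ⟶ ⦋k⦌)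
    {φ : j ⟶ ⦋n + l⦌} (h : Mem (boundaryJoin n l) φ) :
    Mem (boundaryJoin n k) (φ ≫ (ordinalSum n).map α) := by
  obtain ⟨i, hi, hφ⟩ := mem_boundaryJoin.1 h
  refine mem_boundaryJoin.2 ⟨⟨i.val, by omega⟩, hi, fun a e => hφ a (Fin.ext ?_)⟩
  have e' : (((ordinalSum n).map α).toOrderHom (φ.toOrderHom a)).val = i.val :=
    congrArg Fin.val e
  by_cases h : (φ.toOrderHom a).val < n
  · rwa [ordinalSum_map_val_of_lt n α _ h] at e'
  · rw [ordinalSum_map_val_of_not_lt n α _ h] at e'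
    omega

/-- The condition that `x` lies in the `l`-simplices of the relative higher morphism space. -/
def IsHigherMorphism (f : X ⟶ Y) (n l : ℕ) (x : U ⟶ X.obj (op ⦋n + l⦌)) : Prop :=
  ∃ h : RelCone f (SSet.horn n (Fin.last n)) U,
    (RelCone.restriction f (boundaryJoin n l)).precomp x =
      h.pull (collapse n l) (boundaryJoin_le n l)

lemma IsHigherMorphism.comp {k l : ℕ} {x : U ⟶ X.obj (op ⦋n + k⦌)} (hx : IsHigherMorphism f n k x)
    (α : (⦋n + l⦌ : SimplexCategory) ⟶ ⦋n + k⦌) (hα : α ≫ collapse n k = collapse n l)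
    (hα' : ∀ ⦃j : SimplexCategory⦄ (φ : j ⟶ ⦋n + l⦌), Mem (boundaryJoin n l) φ →
      Mem (boundaryJoin n k) (φ ≫ α)) : IsHigherMorphism f n l (x ≫ X.map α.op) := by
  obtain ⟨h, e⟩ := hx
  refine ⟨h, RelCone.ext' ?_ fun j φ hφ => ?_⟩
  · have e' : x ≫ f.app _ = h.base ≫ Y.map (collapse n k).op := congrArg RelCone.base e
    rw [RelCone.precomp_base, RelCone.restriction_base, RelCone.pull_base, Category.assoc,
      f.naturality, reassoc_of% e', ← Y.map_comp, ← op_comp, hα]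
  · have e' : x ≫ X.map (φ ≫ α).op = h.lift.at' ((φ ≫ α) ≫ collapse n k) _ :=
      congrArg (fun t => t.lift.at' _ (hα' φ hφ)) e
    rw [RelCone.precomp_lift, RelCone.restriction_lift, HomCone.precomp_at',
      HomCone.restriction_at', Category.assoc, ← X.map_comp, ← op_comp, e', RelCone.pull_lift_at']
    exact h.lift.at'_congr (by rw [Category.assoc, hα]) _ _

/-- The restriction from `X_{n+l}` is a cover, so the defining pullback exists; it is a subobject
because `x` determines its horn. -/
lemma exists_representing_isHigherMorphism (hW : IsPullbackClass W) (f : X ⟶ Y)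
    (hf : ∀ k : ℕ, RelRestrictionHas W f (SSet.boundary k)) (n l : ℕ) :
    ∃ (P : C) (ι : P ⟶ X.obj (op ⦋n + l⦌)), IsHigherMorphism f n l ι ∧
      ∀ ⦃U : C⦄ (x : U ⟶ X.obj (op ⦋n + l⦌)), IsHigherMorphism f n l x →
        ∃! g : U ⟶ P, g ≫ ι = x := by
  obtain ⟨L, c, hc⟩ := exists_isUniversal hW f (SSet.horn n (Fin.last n)) fun d _ _ _ => hf d
  obtain ⟨F, c', hc'⟩ := exists_isUniversal hW f (boundaryJoin n l) fun d _ _ _ => hf d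
  obtain ⟨r, hr, hrW⟩ := hc'.exists_restriction hW fun d _ _ _ => hf d
  obtain ⟨g, hg, -⟩ := hc' L (c.pull (collapse n l) (boundaryJoin_le n l))
  have := hW.hasPullback r g hrW
  have hcond : ∀ {U : C} (x : U ⟶ X.obj (op ⦋n + l⦌)) (y : U ⟶ L), x ≫ r = y ≫ g ↔
      (RelCone.restriction f (boundaryJoin n l)).precomp x =
        (c.precomp y).pull (collapse n l) (boundaryJoin_le n l) := by
    intro U x y
    rw [RelCone.pull_precomp, ← hg, ← hr, ← RelCone.precomp_comp, ← RelCone.precomp_comp]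
    exact ⟨fun e => by rw [e], fun e => hc'.hom_ext e⟩
  refine ⟨pullback r g, pullback.fst r g, ⟨c.precomp (pullback.snd r g),
    (hcond _ _).1 pullback.condition⟩, ?_⟩
  rintro U x ⟨h, e⟩
  obtain ⟨y, rfl, -⟩ := hc U h
  refine ⟨pullback.lift x y ((hcond _ _).2 e), pullback.lift_fst _ _ _, fun z hz => ?_⟩
  apply pullback.hom_ext
  · exact hz.trans (pullback.lift_fst _ _ _).symm
  · rw [pullback.lift_snd]
    apply hc.hom_ext
    apply pull_collapse_injective (l := l)
    rw [← e]
    refine ((hcond _ _).1 ?_).symm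
    rw [← hz, Category.assoc, pullback.condition, Category.assoc]

theorem exists_isHigherMorphismSpace (hW : IsPullbackClass W) (f : X ⟶ Y)
    (hf : ∀ k : ℕ, RelRestrictionHas W f (SSet.boundary k)) (n : ℕ) :
    ∃ (P : SimplicialObject C) (ι : P ⟶ dec n X), IsHigherMorphismSpace f n ι := by
  have key := exists_simplicialObject_of_subobjects (dec n X)
    (fun l _ x => IsHigherMorphism f n l x)
    (fun k l α U x hx => IsHigherMorphism.comp (f := f) hx ((ordinalSum n).map α)
      (ordinalSum_map_collapse n α) fun _ _ => mem_boundaryJoin_ordinalSum α)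
    (exists_representing_isHigherMorphism hW f hf n)
  obtain ⟨P, ι, h⟩ := key
  exact ⟨P, ι, fun l => (h l).1, fun l U x t e => (h l).2 x ⟨t, e⟩⟩

end HigherStack

namespace HigherStack

variable {C : Type u} [Category.{v} C] {X Y T : SimplicialObject C} {f : X ⟶ Y} {q : X ⟶ T}
  {p : T ⟶ Y} {k n : ℕ} {A B S : (Δ[k] : SSet.{0}).Subcomplex} {U V M : C}
  {i j : SimplexCategory} {Q W : MorphismProperty C}

/-! ### The orbit space of the higher morphism space -/

lemma IsCoverClass.epi (hW : IsCoverClass W) {M N : C} (s : M ⟶ N) (hs : W s) : Epi s := by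
  have := hW.hasPullback s s hs
  obtain ⟨h⟩ := hW.effective s hs _ _ (IsKernelPair.of_hasPullback s)
  exact ⟨fun g g' e => Cofork.IsColimit.hom_ext h e⟩

/-- The face of `Δ^{n-1} ⋆ Δ^1` omitting the last vertex (for `i = 0`) or the first vertex
(for `i = 1`) of the second factor. -/
def joinFace (n : ℕ) (i : Fin 2) : (⦋n⦌ : SimplexCategory) ⟶ ⦋n + 1⦌ :=
  (ordinalSum n).map (SimplexCategory.δ i : ⦋0⦌ ⟶ ⦋1⦌)

lemma joinFace_collapse (n : ℕ) (i : Fin 2) : joinFace n i ≫ collapse n 1 = 𝟙 _ := by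
  refine (ordinalSum_map_collapse n (k := 1) (l := 0) (SimplexCategory.δ i)).trans ?_
  ext a : 3
  apply Fin.ext
  change min a.val n = a.val
  have := a.isLt
  simp only [SimplexCategory.len_mk] at this
  omega

lemma joinFace_val_of_lt (n : ℕ) (i : Fin 2) (a : Fin (n + 1)) (h : a.val < n) :
    ((joinFace n i).toOrderHom a).val = a.val :=
  ordinalSum_map_val_of_lt n (l := ⦋0⦌) (m := ⦋1⦌) (SimplexCategory.δ i) a h

/-- The vertex of `Δ^0` goes to `1` under `δ 0`, so this face skips `n` and ends at `n + 1`. -/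
lemma joinFace_zero_val_ne (n : ℕ) (a : Fin (n + 1)) : ((joinFace n 0).toOrderHom a).val ≠ n := by
  by_cases h : a.val < n
  · rw [joinFace_val_of_lt n 0 a h]
    omega
  · have e : ((joinFace n 0).toOrderHom a).val = n + 1 :=
      (ordinalSum_map_val_of_not_lt n (l := ⦋0⦌) (m := ⦋1⦌) (SimplexCategory.δ 0) a h).trans
        (congrArg (fun b : Fin 1 => n + ((SimplexCategory.δ (n := 0) 0).toOrderHom b).val)
          (Subsingleton.elim _ (0 : Fin 1)))
    omega

lemma joinFace_one_val (n : ℕ) (a : Fin (n + 1)) :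
    ((joinFace n 1).toOrderHom a).val = a.val := by
  by_cases h : a.val < n
  · rw [joinFace_val_of_lt n 1 a h]
  · have e : ((joinFace n 1).toOrderHom a).val = n + 0 :=
      (ordinalSum_map_val_of_not_lt n (l := ⦋0⦌) (m := ⦋1⦌) (SimplexCategory.δ 1) a h).trans
        (congrArg (fun b : Fin 1 => n + ((SimplexCategory.δ (n := 0) 1).toOrderHom b).val)
          (Subsingleton.elim _ (0 : Fin 1)))
    omega

/-- The simplex `φ` of `Δ^{n+1}` does not contain the vertex `n`. -/
def Avoids (n : ℕ) (φ : j ⟶ ⦋n + 1⦌) : Prop := ∀ a, (φ.toOrderHom a).val ≠ n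

/-- Consistency of the sphere: passing to a face may switch from `a` to `b`, so it must land where
they agree. If `φ` misses a vertex below `n`, so does the collapse. Otherwise `φ` misses `n + 1`,
and then `ψ ≫ φ` misses both vertices collapsed to `n`. -/
lemma mem_boundary_comp_collapse (φ : j ⟶ ⦋n + 1⦌) (ψ : i ⟶ j)
    (hφ : Mem (SSet.boundary (n + 1)) φ) (h : ¬ Avoids n φ) (h' : Avoids n (ψ ≫ φ)) :
    Mem (SSet.boundary n) (ψ ≫ φ ≫ collapse n 1) := by
  obtain ⟨b, hb⟩ := mem_boundary.1 hφ
  have hval : ∀ a, ((ψ ≫ φ ≫ collapse n 1).toOrderHom a).val =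
      min (φ.toOrderHom (ψ.toOrderHom a)).val n := fun _ => rfl
  by_cases hbn : b.val < n
  · refine mem_boundary.2 ⟨⟨b.val, Nat.lt_succ_of_lt hbn⟩, fun a e => hb (ψ.toOrderHom a) (Fin.ext ?_)⟩
    have e' := (hval a).symm.trans (congrArg Fin.val e)
    dsimp only at e'
    omega
  · have hb' : b.val = n + 1 := by
      have hb₁ : b.val < n + 2 := b.isLt
      simp only [Avoids, not_forall, not_not] at h
      obtain ⟨a, ha⟩ := h
      have : b.val ≠ n := fun e => hb a (Fin.ext (ha.trans e.symm))
      omega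
    refine mem_boundary.2 ⟨Fin.last n, fun a e => ?_⟩
    have e' : min (φ.toOrderHom (ψ.toOrderHom a)).val n = n :=
      (hval a).symm.trans (congrArg Fin.val e)
    have h₁ : (φ.toOrderHom (ψ.toOrderHom a)).val ≠ n := h' a
    have h₂ : (φ.toOrderHom (ψ.toOrderHom a)).val ≠ n + 1 := fun e'' =>
      hb (ψ.toOrderHom a) (Fin.ext (e''.trans hb'.symm))
    have h₃ := (φ.toOrderHom (ψ.toOrderHom a)).isLt
    simp only [SimplexCategory.len_mk] at h₃
    omega

open Classical in
/-- Two `n`-simplices `a`, `b` of `X` with the same boundary and the same image in `Y` give a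
sphere in `X` over a degenerate simplex of `Y`, with the other faces degenerate. -/
noncomputable def homotopySphere (f : X ⟶ Y) (a b : U ⟶ X.obj (op ⦋n⦌))
    (hab : ∀ ⦃j : SimplexCategory⦄ (φ : j ⟶ ⦋n⦌), Mem (SSet.boundary n) φ →
      a ≫ X.map φ.op = b ≫ X.map φ.op)
    (hf : a ≫ f.app (op ⦋n⦌) = b ≫ f.app (op ⦋n⦌)) : RelCone f (SSet.boundary (n + 1)) U :=
  RelCone.mk'
    (HomCone.ofFamily
      -- The face opposite `n` is `b`, the face opposite `n + 1` is `a`, and the others are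
      -- degeneracies of faces of `a`.
      (fun φ _ => (if Avoids n φ then b else a) ≫ X.map (φ ≫ collapse n 1).op)
      (fun {i j} ψ φ hφ => by
        rw [Category.assoc, ← X.map_comp, ← op_comp, Category.assoc]
        by_cases h : Avoids n φ
        · rw [if_pos h, if_pos (show Avoids n (ψ ≫ φ) from fun a => h (ψ.toOrderHom a))]
        · rw [if_neg h]
          split_ifs with h'
          · exact hab _ (mem_boundary_comp_collapse φ ψ hφ h h')
          · rfl))
    ((a ≫ f.app (op ⦋n⦌)) ≫ Y.map (collapse n 1).op)
    (fun j φ hφ => by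
      rw [HomCone.ofFamily_at', Category.assoc, f.naturality, Category.assoc, ← Y.map_comp,
        ← op_comp]
      split_ifs
      · rw [← Category.assoc, ← hf]
      · rw [← Category.assoc])

/-- In level `0` the collapse is the identity and the condition is empty; hence `P_0 ≅ X_n`. -/
lemma IsHigherMorphism.of_zero (x : U ⟶ X.obj (op ⦋n⦌)) : IsHigherMorphism f n 0 x := by
  have e : collapse n 0 = 𝟙 (⦋n⦌ : SimplexCategory) := by
    rw [← ordinalSum_map_collapse n (SimplexCategory.δ 0 : ⦋0⦌ ⟶ ⦋1⦌)]
    exact joinFace_collapse n 0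
  refine ⟨(RelCone.restriction f _).precomp x, RelCone.ext' ?_ fun j φ hφ => ?_⟩
  · change x ≫ f.app (op ⦋n⦌) = (x ≫ f.app (op ⦋n⦌)) ≫ Y.map (collapse n 0).op
    rw [e]
    simp
  · change x ≫ X.map φ.op = x ≫ X.map (φ ≫ collapse n 0).op
    rw [e]
    exact congrArg (fun g => x ≫ X.map g.op) (Category.comp_id φ).symm

lemma IsHigherMorphismSpace.isIso {P : SimplicialObject C} {ι : P ⟶ dec n X}
    (h : IsHigherMorphismSpace f n ι) :
    IsIso (ι.app (op ⦋0⦌) ≫ decZero n X) := by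
  have e : ι.app (op ⦋0⦌) ≫ decZero n X = ι.app (op ⦋0⦌) := Category.comp_id _
  rw [e]
  obtain ⟨t, ht⟩ := IsHigherMorphism.of_zero (f := f) (𝟙 (X.obj (op ⦋n⦌)))
  obtain ⟨g, hg, -⟩ := h.universal 0 _ (𝟙 _) t ht
  obtain ⟨t', ht'⟩ := h.condition 0
  refine ⟨g, (h.universal 0 _ (ι.app (op ⦋0⦌)) t' ht').unique ?_ (Category.id_comp _), hg⟩
  exact (Category.assoc _ _ _).trans ((congrArg _ hg).trans (Category.comp_id _))

/-- The endpoints of a higher morphism agree on the boundary and in `Y`. -/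
lemma IsHigherMorphism.endpoints {x : U ⟶ X.obj (op ⦋n + 1⦌)} (hx : IsHigherMorphism f n 1 x) :
    (RelCone.restriction f (SSet.boundary n)).precomp (x ≫ X.map (joinFace n 0).op) =
      (RelCone.restriction f (SSet.boundary n)).precomp (x ≫ X.map (joinFace n 1).op) := by
  obtain ⟨h, e⟩ := hx
  have hbase : ∀ i, (x ≫ X.map (joinFace n i).op) ≫ f.app (op ⦋n⦌) = h.base := fun i => by
    have e' : x ≫ f.app (op ⦋n + 1⦌) = h.base ≫ Y.map (collapse n 1).op := congrArg RelCone.base e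
    rw [Category.assoc, f.naturality, reassoc_of% e', ← Y.map_comp, ← op_comp, joinFace_collapse,
      op_id, Y.map_id, Category.comp_id]
  refine RelCone.ext' ((hbase 0).trans (hbase 1).symm) fun j φ hφ => ?_
  change (x ≫ X.map (joinFace n 0).op) ≫ X.map φ.op = (x ≫ X.map (joinFace n 1).op) ≫ X.map φ.op
  rw [Category.assoc, Category.assoc, ← X.map_comp, ← X.map_comp, ← op_comp, ← op_comp]
  obtain ⟨b, hb⟩ := mem_boundary.1 hφ
  -- If `φ` misses a vertex `b < n`, both faces of it lie in the join, where `x` is constant along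
  -- the second factor.
  by_cases hbn : b.val < n
  · have hmem : ∀ i, Mem (boundaryJoin n 1) (φ ≫ joinFace n i) := fun i => by
      refine mem_boundaryJoin.2 ⟨⟨b.val, by omega⟩, hbn, fun a e => hb a (Fin.ext ?_)⟩
      have e' : ((joinFace n i).toOrderHom (φ.toOrderHom a)).val = b.val := congrArg Fin.val e
      by_cases h : (φ.toOrderHom a).val < n
      · rwa [joinFace_val_of_lt n i _ h] at e'
      · have h₁ := joinFace_collapse n i
        have h₂ : min ((joinFace n i).toOrderHom (φ.toOrderHom a)).val n = (φ.toOrderHom a).val :=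
          congrArg (fun g => (g.toOrderHom (φ.toOrderHom a)).val) h₁
        omega
    have hat : ∀ i, x ≫ X.map (φ ≫ joinFace n i).op =
        h.lift.at' ((φ ≫ joinFace n i) ≫ collapse n 1) (boundaryJoin_le n 1 _ (hmem i)) :=
      fun i => congrArg (fun t => t.lift.at' _ (hmem i)) e
    rw [hat 0, hat 1]
    exact h.lift.at'_congr (by
      rw [Category.assoc, Category.assoc, joinFace_collapse, joinFace_collapse]) _ _
  -- Otherwise `φ` misses `n`, and the two inclusions agree on the remaining vertices.
  · have : φ ≫ joinFace n 0 = φ ≫ joinFace n 1 := by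
      ext a : 3
      apply Fin.ext
      change ((joinFace n 0).toOrderHom (φ.toOrderHom a)).val =
        ((joinFace n 1).toOrderHom (φ.toOrderHom a)).val
      have h : (φ.toOrderHom a).val < n := by
        have h₁ := (φ.toOrderHom a).isLt
        have h₂ := b.isLt
        simp only [SimplexCategory.len_mk] at h₁ h₂
        have : (φ.toOrderHom a).val ≠ b.val := fun e => hb a (Fin.ext e)
        omega
      rw [joinFace_val_of_lt n 0 _ h, joinFace_val_of_lt n 1 _ h]
    rw [this]

/-- Two `n`-simplices which agree on the boundary and in `Y` are, after passage to a cover, the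
endpoints of a higher morphism. -/
lemma exists_isHigherMorphism (hW : IsCoverClass W)
    (hf : RelRestrictionHas W f (SSet.boundary (n + 1))) (a b : U ⟶ X.obj (op ⦋n⦌))
    (hab : (RelCone.restriction f (SSet.boundary n)).precomp a =
      (RelCone.restriction f (SSet.boundary n)).precomp b) :
    ∃ (E : C) (s : E ⟶ U) (x : E ⟶ X.obj (op ⦋n + 1⦌)), W s ∧ IsHigherMorphism f n 1 x ∧
      x ≫ X.map (joinFace n 0).op = s ≫ b ∧ x ≫ X.map (joinFace n 1).op = s ≫ a := by
  have habl : ∀ ⦃j : SimplexCategory⦄ (φ : j ⟶ ⦋n⦌), Mem (SSet.boundary n) φ →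
      a ≫ X.map φ.op = b ≫ X.map φ.op := fun j φ hφ =>
    congrArg (fun t => t.lift.at' φ hφ) hab
  have habf : a ≫ f.app (op ⦋n⦌) = b ≫ f.app (op ⦋n⦌) := congrArg RelCone.base hab
  obtain ⟨K, κ, hκ, μ, hμ, hμW⟩ := hf
  obtain ⟨g, hg, -⟩ := hκ U (homotopySphere f a b habl habf)
  -- The cover of `U` is the base change of the matching map along the sphere; the other projection
  -- is the filler.
  have := hW.hasPullback μ g hμW
  have := hW.isStableUnderBaseChange
  have e : (RelCone.restriction f (SSet.boundary (n + 1))).precomp (pullback.fst μ g) =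
      (homotopySphere f a b habl habf).precomp (pullback.snd μ g) := by
    rw [← hμ, ← hg, ← RelCone.precomp_comp, ← RelCone.precomp_comp, pullback.condition]
  set s := pullback.snd μ g
  set x := pullback.fst μ g
  classical
  have hx : ∀ ⦃j : SimplexCategory⦄ (φ : j ⟶ ⦋n + 1⦌), Mem (SSet.boundary (n + 1)) φ →
      x ≫ X.map φ.op = s ≫ (if Avoids n φ then b else a) ≫ X.map (φ ≫ collapse n 1).op :=
    fun j φ hφ => congrArg (fun t => t.lift.at' φ hφ) e
  have hxf : x ≫ f.app (op ⦋n + 1⦌) = s ≫ (a ≫ f.app (op ⦋n⦌)) ≫ Y.map (collapse n 1).op :=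
    congrArg RelCone.base e
  refine ⟨pullback μ g, s, x, MorphismProperty.pullback_snd _ _ hμW,
    ⟨(RelCone.restriction f _).precomp (s ≫ a), RelCone.ext' ?_ fun j φ hφ => ?_⟩, ?_, ?_⟩
  · change x ≫ f.app (op ⦋n + 1⦌) = ((s ≫ a) ≫ f.app (op ⦋n⦌)) ≫ Y.map (collapse n 1).op
    rw [hxf]
    simp only [Category.assoc]
  · change x ≫ X.map φ.op = (s ≫ a) ≫ X.map (φ ≫ collapse n 1).op
    have hφ' : Mem (SSet.boundary (n + 1)) φ := by
      obtain ⟨i, -, hi⟩ := mem_boundaryJoin.1 hφ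
      exact mem_boundary.2 ⟨i, hi⟩
    rw [hx φ hφ', Category.assoc]
    split_ifs
    -- The collapsed simplex lies in the horn, where `a` and `b` agree, so the choice between them
    -- is immaterial.
    · rw [habl]
      exact (show Mem (SSet.horn n (Fin.last n)) (φ ≫ collapse n 1) from
        boundaryJoin_le n 1 _ hφ).mono (horn_le_boundary _)
    · rfl
  · rw [hx _ (mem_boundary_of_lt _ (Nat.lt_succ_self n)),
      if_pos (show Avoids n (joinFace n 0) from joinFace_zero_val_ne n),
      joinFace_collapse]
    simp
  · rw [hx _ (mem_boundary_of_lt _ (Nat.lt_succ_self n)), if_neg, joinFace_collapse]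
    · simp
    · intro h
      exact h (Fin.last n) (joinFace_one_val n (Fin.last n))

/-- The orbit space of the higher morphism space is the matching object. -/
theorem IsHigherMorphismSpace.isOrbitSpace (hW : IsCoverClass W)
    (hf : RelRestrictionHas W f (SSet.boundary (n + 1))) {P : SimplicialObject C}
    {ι : P ⟶ dec n X} (hP : IsHigherMorphismSpace f n ι) {c : RelCone f (SSet.boundary n) M}
    (hc : c.IsUniversal) {r : X.obj (op ⦋n⦌) ⟶ M}
    (hr : c.precomp r = RelCone.restriction f (SSet.boundary n)) (hrW : W r) :
    IsOrbitSpace W P ((ι.app (op ⦋0⦌) ≫ decZero n X) ≫ r) := by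
  have := hW.isMultiplicative
  have hiso := hP.isIso
  obtain ⟨y, hy, hyu, hface⟩ : ∃ y : P.obj (op ⦋1⦌) ⟶ X.obj (op ⦋n + 1⦌),
      IsHigherMorphism f n 1 y ∧
      (∀ ⦃E : C⦄ (x : E ⟶ X.obj (op ⦋n + 1⦌)), IsHigherMorphism f n 1 x → ∃ g, g ≫ y = x) ∧
      ∀ i : Fin 2, P.δ i ≫ ι.app (op ⦋0⦌) ≫ decZero n X = y ≫ X.map (joinFace n i).op := by
    refine ⟨ι.app (op ⦋1⦌), hP.condition 1, fun E x ⟨h, hx⟩ => (hP.universal 1 E x h hx).exists,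
      fun i => ?_⟩
    have e₁ : ι.app (op ⦋0⦌) ≫ decZero n X = ι.app (op ⦋0⦌) := Category.comp_id _
    rw [e₁]
    exact ι.naturality (SimplexCategory.δ i).op
  set z := ι.app (op ⦋0⦌) ≫ decZero n X
  have hw : P.δ (0 : Fin 2) ≫ z ≫ r = P.δ (1 : Fin 2) ≫ z ≫ r := by
    rw [reassoc_of% (hface 0), reassoc_of% (hface 1), ← Category.assoc, ← Category.assoc]
    apply hc.hom_ext
    rw [c.precomp_comp r, c.precomp_comp r, hr]
    exact hy.endpoints
  refine ⟨W.comp_mem _ _ (hW.isPullbackClass.of_isIso z) hrW, hw, ?_⟩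
  have := hW.hasPullback r r hrW
  have hk := IsKernelPair.of_hasPullback r
  obtain ⟨hcolim⟩ := hW.effective r hrW _ _ hk
  have hepi := hW.epi r hrW
  -- After the cover `s`, the kernel pair of `r` factors through `P_1`. As `s` is epi, `inv z ≫ t`
  -- equalizes the kernel pair and descends along `r`.
  have hdesc : ∀ {Z : C} (t : P.obj (op ⦋0⦌) ⟶ Z), P.δ (0 : Fin 2) ≫ t = P.δ (1 : Fin 2) ≫ t →
      ∃ d : M ⟶ Z, (z ≫ r) ≫ d = t := by
    intro Z t ht
    obtain ⟨E, s, x, hs, hx, hx₀, hx₁⟩ := exists_isHigherMorphism hW hf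
      (pullback.fst r r) (pullback.snd r r) (by
        rw [← hr, ← RelCone.precomp_comp, ← RelCone.precomp_comp, pullback.condition])
    obtain ⟨g, hg⟩ := hyu x hx
    have hsepi := hW.epi s hs
    have hg₀ : g ≫ P.δ (0 : Fin 2) = (s ≫ pullback.snd r r) ≫ inv z := by
      rw [IsIso.eq_comp_inv, Category.assoc, hface, ← hx₀, ← hg, Category.assoc]
    have hg₁ : g ≫ P.δ (1 : Fin 2) = (s ≫ pullback.fst r r) ≫ inv z := by
      rw [IsIso.eq_comp_inv, Category.assoc, hface, ← hx₁, ← hg, Category.assoc]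
    have hcoeq : pullback.fst r r ≫ inv z ≫ t = pullback.snd r r ≫ inv z ≫ t := by
      rw [← cancel_epi s]
      have := congrArg (g ≫ ·) ht
      simp only [reassoc_of% hg₀, reassoc_of% hg₁] at this
      exact this.symm
    refine ⟨Cofork.IsColimit.desc hcolim _ hcoeq, ?_⟩
    have := Cofork.IsColimit.π_desc' hcolim _ hcoeq
    rw [Cofork.π_ofπ] at this
    rw [Category.assoc, this, IsIso.hom_inv_id_assoc]
  exact ⟨Cofork.IsColimit.mk' _ fun s =>
    ⟨(hdesc s.π s.condition).choose, (hdesc s.π s.condition).choose_spec, fun {m} hm => by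
      rw [← cancel_epi (z ≫ r)]
      exact (hm : (z ≫ r) ≫ m = _).trans (hdesc s.π s.condition).choose_spec.symm⟩⟩

/-! ### Strictifications -/

lemma RelCone.IsUniversal.precomp_isIso {c : RelCone f A M} (hc : c.IsUniversal) (θ : V ⟶ M)
    [IsIso θ] : (c.precomp θ).IsUniversal := by
  intro U t
  obtain ⟨g, hg, -⟩ := hc U t
  refine ⟨g ≫ inv θ, ?_, fun g' hg' => ?_⟩
  · dsimp only
    rw [← RelCone.precomp_comp]
    simpa using hg
  · rw [IsIso.eq_comp_inv]
    apply hc.hom_ext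
    rw [RelCone.precomp_comp, hg, hg']

/-- The property does not depend on the chosen limit. -/
lemma RelRestrictionHas.prop_of_isUniversal (hQ : IsPullbackClass Q) (h : RelRestrictionHas Q f A)
    {c : RelCone f A M} (hc : c.IsUniversal) {r : X.obj (op ⦋k⦌) ⟶ M}
    (hr : c.precomp r = RelCone.restriction f A) : Q r := by
  have := hQ.isMultiplicative
  obtain ⟨M', c', hc', r', hr', hQr'⟩ := h
  obtain ⟨g, hg, -⟩ := hc _ c'
  obtain ⟨g', hg', -⟩ := hc' _ c
  have : IsIso g := ⟨g', hc'.hom_ext (by rw [RelCone.precomp_comp, hg', hg, RelCone.precomp_id]),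
    hc.hom_ext (by rw [RelCone.precomp_comp, hg, hg', RelCone.precomp_id])⟩
  have e : r = r' ≫ g := hc.hom_ext (by rw [RelCone.precomp_comp, hg, hr', hr])
  rw [e]
  exact Q.comp_mem _ _ hQr' (hQ.of_isIso g)

/-- `T_n` and `M_n(f)` are both coequalizers of the face maps of one `P`, hence isomorphic under
`X_n`, and `M_n(f) = M_n(p)`. -/
lemma IsStrictification.isUniversal_restriction_boundary (hW : IsCoverClass W)
    (hf : ∀ k : ℕ, RelRestrictionHas W f (SSet.boundary k)) (h : IsStrictification W n f q p) :
    (RelCone.restriction p (SSet.boundary n)).IsUniversal := by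
  obtain ⟨P, ι, hP, hW', w, ⟨hcolim⟩⟩ := h.orbit
  obtain ⟨M, c, hc, r, hr, hrW⟩ := hf n
  obtain ⟨-, w', ⟨hcolim'⟩⟩ := hP.isOrbitSpace hW (hf (n + 1)) hc hr hrW
  have hiso := hP.isIso
  let θ := hcolim.coconePointUniqueUpToIso hcolim'
  have hθ : q.app (op ⦋n⦌) ≫ θ.hom = r := by
    have e := hcolim.comp_coconePointUniqueUpToIso_hom hcolim' WalkingParallelPair.one
    rw [← cancel_epi (ι.app (op ⦋0⦌) ≫ decZero n X), ← Category.assoc]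
    exact e
  -- This allows maps out of `T_n` to be compared on `X_n`.
  have hepi : Epi (q.app (op ⦋n⦌)) := by
    have := hW.epi _ hW'
    exact epi_of_epi (ι.app (op ⦋0⦌) ≫ decZero n X) _
  have hcp := (RelCone.isUniversal_postcomp_iff (boundary_le_skeleton le_rfl) h.iso_lt h.fac c).2 hc
  have e : (c.postcomp h.fac).precomp θ.hom = RelCone.restriction p (SSet.boundary n) := by
    refine RelCone.ext' ?_ fun j φ hφ => ?_
    · rw [← cancel_epi (q.app (op ⦋n⦌))]
      change q.app (op ⦋n⦌) ≫ θ.hom ≫ c.base = q.app (op ⦋n⦌) ≫ p.app (op ⦋n⦌)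
      rw [reassoc_of% hθ]
      exact (congrArg RelCone.base hr).trans (congrArg (fun g => g.app (op ⦋n⦌)) h.fac.symm)
    · rw [← cancel_epi (q.app (op ⦋n⦌))]
      change q.app (op ⦋n⦌) ≫ θ.hom ≫ c.lift.at' φ hφ ≫ q.app (op j) =
        q.app (op ⦋n⦌) ≫ T.map φ.op
      have hl : r ≫ c.lift.at' φ hφ = X.map φ.op := congrArg (fun t => t.lift.at' φ hφ) hr
      rw [reassoc_of% hθ, reassoc_of% hl, q.naturality]
  rw [← e]
  exact hcp.precomp_isIso θ.hom

lemma IsStrictification.isRelTruncation (hW : IsCoverClass W)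
    (hf : ∀ k : ℕ, RelRestrictionHas W f (SSet.boundary k)) (h : IsStrictification W n f q p) :
    IsRelTruncation n f q p where
  fac := h.fac
  isIso := h.iso_lt
  matching := HigherStack.isUniversal_restriction_boundary
    (h.isUniversal_restriction_boundary hW hf) 1 (relRestrictionHas_isomorphisms_iff.1 h.horn)
    fun k => relRestrictionHas_isomorphisms_iff.1 (h.coskeletal k)

lemma IsRelTruncation.isStrictification (hW : IsCoverClass W)
    (hf : ∀ k : ℕ, RelRestrictionHas W f (SSet.boundary k)) (h : IsRelTruncation n f q p) :
    IsStrictification W n f q p where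
  fac := h.fac
  iso_lt := h.isIso
  orbit := by
    obtain ⟨P, ι, hP⟩ := exists_isHigherMorphismSpace hW.isPullbackClass f hf n
    refine ⟨P, ι, hP, ?_⟩
    obtain ⟨c, hc⟩ := RelCone.exists_postcomp_eq (boundary_le_skeleton le_rfl) h.isIso h.fac
      (RelCone.restriction p (SSet.boundary n))
    have hcu : c.IsUniversal := by
      rw [← RelCone.isUniversal_postcomp_iff (boundary_le_skeleton le_rfl) h.isIso h.fac, hc]
      exact h.matching n le_rfl
    have hcq : c.precomp (q.app (op ⦋n⦌)) = RelCone.restriction f (SSet.boundary n) := by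
      refine RelCone.ext (HomCone.postcomp_injective (boundary_le_skeleton le_rfl) h.isIso
        (HomCone.ext' fun j φ hφ => ?_)) ?_
      · have hl : c.lift.at' φ hφ ≫ q.app (op j) = T.map φ.op :=
          congrArg (fun t => t.lift.at' φ hφ) hc
        change (q.app (op ⦋n⦌) ≫ c.lift.at' φ hφ) ≫ q.app (op j) = X.map φ.op ≫ q.app (op j)
        rw [Category.assoc, hl, q.naturality]
      · have hb : c.base = p.app (op ⦋n⦌) := congrArg RelCone.base hc
        rw [RelCone.precomp_base, hb]
        exact congrArg (fun g => g.app (op ⦋n⦌)) h.fac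
    exact hP.isOrbitSpace hW (hf (n + 1)) hcu hcq
      ((hf n).prop_of_isUniversal hW.isPullbackClass hcu hcq)
  -- The horn, like the skeleton below, contains all cells of dimension `< n`, so only invertible
  -- matching maps of `p` intervene.
  horn := relRestrictionHas_isomorphisms_iff.2 (h.isUniversal_restriction hW.isPullbackClass hf
    fun d σ hσ hσA => by
      by_contra hd
      exact hσA (mem_horn_of_lt 1 σ (not_le.1 hd)))
  coskeletal k := relRestrictionHas_isomorphisms_iff.2
    (h.isUniversal_restriction hW.isPullbackClass hf fun d σ hσ hσA => by
      by_contra hd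
      exact hσA (mem_skeleton_of_lt σ (show d < n + 2 by omega)))

end HigherStack

/-! ### The proposition. -/

theorem mainTheorem6 {C : Type u} [Category.{v} C] (W : MorphismProperty C)
    (hW : HigherStack.IsCoverClass W) (n : ℕ) {X Y : SimplicialObject C} (f : X ⟶ Y)
    (hf : HigherStack.IsHypercover W ⊤ f) :
    (∃ (T : SimplicialObject C) (q : X ⟶ T) (p : T ⟶ Y),
      HigherStack.IsStrictification W n f q p) ∧
    ∀ (T : SimplicialObject C) (q : X ⟶ T) (p : T ⟶ Y),
      HigherStack.IsStrictification W n f q p →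
        HigherStack.IsHypercover W (n : ℕ∞) p ∧
        HigherStack.IsHypercover W ⊤ q ∧
        HigherStack.IsRelCoskeleton n f q p := by
  constructor
  · obtain ⟨T, q, p, h⟩ := HigherStack.exists_isRelCoskeleton hW.isPullbackClass f hf.cover n
    exact ⟨T, q, p, h.isRelTruncation.isStrictification hW hf.cover⟩
  · intro T q p h
    have ht := h.isRelTruncation hW hf.cover
    exact ⟨ht.isHypercover_right hW.isPullbackClass hf, ht.isHypercover_left hW.isPullbackClass hf,
      ht.isRelCoskeleton hW.isPullbackClass hf.cover⟩
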